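/- All vector spaces are real; "operator" means bounded linear operator and "lattice homomorphism" means linear lattice homomorphism (between Banach lattices these are automatically bounded). For $m\ge 1$ let $\mathcal{H}_m$ be the vector lattice of continuous, positively homogeneous functions $\mathbb{R}^m\to\mathbb{R}$, with coordinate projections $\pi_1,\dots,\pi_m$. For elements $x_1,\dots,x_m$ of a Banach lattice $X$ and $h\in\mathcal{H}_m$, $h(x_1,\dots,x_m)\in X$ denotes the image of $h$ under the unique lattice homomorphism $\mathcal{H}_m\to X$ with $\pi_k\mapsto x_k$ for each $k$; in vector lattices of real functions which are closed under such operations (applied pointwise), the same notation is used. A *convexity condition* is a triple $\mathcal{D}=(\mathcal{G},M,\vartheta)$, where $\mathcal{G}$ is a nonempty set of functions, each belonging to some $\mathcal{H}_m$, $m\ge1$, and monotone on $\mathbb{R}^m_+$, and $M\colon\mathcal{G}\to[1,\infty)$ and $\vartheta\colon\mathcal{G}\to\{0,1\}$ are any functions. A lattice seminorm $\nu$ is *$\mathcal{D}$-convex* if $$\nu\bigl(g(x_1,\dots,x_m)\bigr)\le M(g)\, g\bigl(\nu(x_1),\dots,\nu(x_m)\bigr)$$ for every $m$-variable $g\in\mathcal{G}$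 and all positive $x_1,\dots,x_m$, which are in addition required to be pairwise disjoint if $\vartheta(g)=0$. A Banach lattice is $\mathcal{D}$-convex if its norm is. Write $\mathcal{D}'\le\mathcal{D}$ if every $\mathcal{D}$-convex Banach lattice is $\mathcal{D}'$-convex. For a Banach space $E$ let $\delta_x\colon B_{E^*}\to\mathbb{R}$, $\delta_x(x^*)=x^*(x)$, for $x\in E$, where $B_{E^*}$ is the closed unit ball of $E^*$. The *free $\mathcal{D}$-convex Banach lattice* $\mathrm{FBL}^{\mathcal{D}}[E]$ is the completion of the vector lattice of functions $Y_0=\{h(\delta_{x_1},\dots,\delta_{x_m}) : m\ge1,\ h\in\mathcal{H}_m,\ x_1,\dots,x_m\in E\}$ with respect to the norm $\|f\|_{\mathcal{D}}=\sup\nu(f)$, the supremum being over all $\mathcal{D}$-convex lattice seminorms $\nu$ on $Y_0$ with $\nu(\delta_x)\le\|x\|$ for all $x\in E$. For a closed ideal $J$ of a Banach lattice $X$, let $Q\colon X\to X/J$ denote the quotient homomorphism. A Banach lattice $P$ is *projective for $\mathcal{D}$-convex Banach lattices* if for every closed ideal $J$ of a $\mathcal{D}$-convex Banach lattice $X$,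 every lattice homomorphism $T\colon P\to X/J$ and every $\varepsilon>0$ there is a lattice homomorphism $\widehat{T}\colon P\to X$ with $T=Q\circ\widehat{T}$ and $\|\widehat{T}\|\le(1+\varepsilon)\|T\|$. A Banach space $E$ is *linearly projective for $\mathcal{D}$-convex Banach lattices* if for every closed ideal $J$ of a $\mathcal{D}$-convex Banach lattice $X$, every operator $T\colon E\to X/J$ and every $\varepsilon>0$ there is an operator $\widehat{T}\colon E\to X$ with $T=Q\circ\widehat{T}$ and $\|\widehat{T}\|\le(1+\varepsilon)\|T\|$. **Proposition.** Let $\mathcal{D}$ and $\mathcal{D}'$ be convexity conditions with $\mathcal{D}'\le\mathcal{D}$. Then the following three conditions are equivalent for a Banach space $E$: 1. $E$ is linearly projective for $\mathcal{D}$-convex Banach lattices. 2. $\mathrm{FBL}^{\mathcal{D}'}[E]$ is projective for $\mathcal{D}$-convex Banach lattices. 3. For every closed ideal $J$ of a $\mathcal{D}$-convex Banach lattice $X$, every lattice homomorphism $T\colon\mathrm{FBL}^{\mathcal{D}'}[E]\to X/J$ and every $\varepsilon>0$, there is an operator $\widehat{T}\colon\mathrm{FBL}^{\mathcal{D}'}[E]\to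 X$ such that $T=Q\circ\widehat{T}$ and $\|\widehat{T}\|\le(1+\varepsilon)\|T\|$. -/

import Mathlib

universe u v

noncomputable section

/-! ### Positively homogeneous continuous functions -/

/-- `ℋ_m`: the vector space of continuous, positively homogeneous functions `ℝ^m → ℝ`. It is a
vector lattice for the pointwise operations (the instance below). -/
def PosHom (m : ℕ) : Submodule ℝ ((Fin m → ℝ) → ℝ) where
  carrier := {h | Continuous h ∧ ∀ (r : ℝ) (t : Fin m → ℝ), 0 ≤ r → h (r • t) = r * h t}
  add_mem' := by
    rintro f g ⟨hf, hf'⟩ ⟨hg, hg'⟩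
    refine ⟨hf.add hg, fun r t hr => ?_⟩
    simp only [Pi.add_apply, hf' r t hr, hg' r t hr]
    ring
  zero_mem' := ⟨continuous_const, by simp⟩
  smul_mem' := by
    rintro c f ⟨hf, hf'⟩
    refine ⟨hf.const_smul c, fun r t hr => ?_⟩
    simp only [Pi.smul_apply, smul_eq_mul, hf' r t hr]
    ring

namespace PosHom

variable {m : ℕ}

instance : Max (PosHom m) :=
  ⟨fun f g => ⟨f.1 ⊔ g.1, f.2.1.sup g.2.1, fun r t hr => by
    simp only [Pi.sup_apply, f.2.2 r t hr, g.2.2 r t hr, mul_max_of_nonneg _ _ hr]⟩⟩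

instance : Min (PosHom m) :=
  ⟨fun f g => ⟨f.1 ⊓ g.1, f.2.1.inf g.2.1, fun r t hr => by
    simp only [Pi.inf_apply, f.2.2 r t hr, g.2.2 r t hr, mul_min_of_nonneg _ _ hr]⟩⟩

/-- The pointwise lattice structure. -/
instance : Lattice (PosHom m) :=
  Function.Injective.lattice (fun f : PosHom m => f.1) Subtype.val_injective
    Iff.rfl Iff.rfl (fun _ _ => rfl) (fun _ _ => rfl)

/-- The `k`-th coordinate projection, an element of `ℋ_m`. -/
def proj (k : Fin m) : PosHom m :=
  ⟨fun t => t k, continuous_apply k, fun _ _ _ => rfl⟩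

/-- `h ∈ ℋ_m` is monotone on `ℝ^m_+`. -/
def MonotoneOnPos (h : PosHom m) : Prop :=
  ∀ t s : Fin m → ℝ, (∀ k, 0 ≤ t k) → (∀ k, t k ≤ s k) → h.1 t ≤ h.1 s

theorem exists_bound (h : PosHom m) : ∃ C : ℝ, 0 ≤ C ∧ ∀ t, |h.1 t| ≤ C * ‖t‖ := by
  obtain ⟨C, hC⟩ := (isCompact_closedBall (0 : Fin m → ℝ) 1).exists_bound_of_continuousOn
    h.2.1.continuousOn
  have hC0 : 0 ≤ C := (norm_nonneg _).trans (hC 0 (by simp))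
  refine ⟨C, hC0, fun t => ?_⟩
  have h1 : h.1 t = ‖t‖ * h.1 (‖t‖⁻¹ • t) := by
    rcases eq_or_ne t 0 with rfl | ht
    · have := h.2.2 0 0 le_rfl
      simpa using this
    · rw [← h.2.2 _ _ (norm_nonneg _), smul_smul, mul_inv_cancel₀ (norm_ne_zero_iff.2 ht), one_smul]
  have h2 : |h.1 (‖t‖⁻¹ • t)| ≤ C := by
    refine hC _ ?_
    rw [mem_closedBall_zero_iff, norm_smul, norm_inv, norm_norm]
    exact inv_mul_le_one
  rw [h1, abs_mul, abs_norm, mul_comm]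
  exact mul_le_mul_of_nonneg_right h2 (norm_nonneg _)

end PosHom

/-! ### Convexity conditions -/

/-- A map between lattices is a lattice homomorphism if it preserves binary suprema and infima. -/
def PreservesLattice {X Y : Type*} [Lattice X] [Lattice Y] (T : X → Y) : Prop :=
  ∀ x y, T (x ⊔ y) = T x ⊔ T y ∧ T (x ⊓ y) = T x ⊓ T y

/-- `Φ` is the positively homogeneous continuous function calculus of a vector lattice at the tuple
`x`: a linear lattice homomorphism on `ℋ_m` which maps the `k`-th coordinate projection to `x k`.
In a Banach lattice (and in a finitely uniformly complete Archimedean vector lattice) there is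
exactly one such `Φ` for each tuple `x`, and `Φ h` is what one denotes by `h(x_1, …, x_m)`. -/
def IsFunctionCalculus {X : Type*} [AddCommGroup X] [Module ℝ X] [Lattice X] {m : ℕ}
    (x : Fin m → X) (Φ : PosHom m →ₗ[ℝ] X) : Prop :=
  PreservesLattice Φ ∧ ∀ k, Φ (PosHom.proj k) = x k

/-- A convexity condition `𝒟 = (𝒢, M, ϑ)`: a nonempty set `𝒢` of continuous positively homogeneous
functions of `m ≥ 1` variables (`m` may vary) which are monotone on `ℝ^m_+`, a function
`M : 𝒢 → [1, ∞)` and a function `ϑ : 𝒢 → {0, 1}`. -/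
structure ConvexityCondition where
  /-- The set `𝒢`. -/
  G : Set (Σ m : ℕ, PosHom m)
  nonempty : G.Nonempty
  one_le_arity : ∀ g ∈ G, 1 ≤ g.1
  monotone : ∀ g ∈ G, PosHom.MonotoneOnPos g.2
  /-- The constants `M(g)`. -/
  M : G → ℝ
  one_le_M : ∀ g, 1 ≤ M g
  /-- `ϑ g = 0`: the inequality for `g` is imposed on pairwise disjoint positive elements only;
  `ϑ g = 1`: it is imposed on all positive elements. -/
  theta : G → Fin 2

/-- A seminorm on a vector lattice is a lattice seminorm if `|x| ≤ |y|` implies `ν x ≤ ν y`. -/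
def IsLatticeSeminorm {X : Type*} [AddCommGroup X] [Module ℝ X] [Lattice X] (ν : Seminorm ℝ X) :
    Prop :=
  ∀ x y : X, |x| ≤ |y| → ν x ≤ ν y

/-- The inequality `ν(g(x_1, …, x_m)) ≤ M(g) g(ν(x_1), …, ν(x_m))` holds for all `g ∈ 𝒢` and all
`x_1, …, x_m ≥ 0`, which are supposed to be pairwise disjoint if `ϑ(g) = 0`. -/
def IsDConvexSeminorm (D : ConvexityCondition) {X : Type*} [AddCommGroup X] [Module ℝ X] [Lattice X]
    (ν : Seminorm ℝ X) : Prop :=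
  ∀ (g : D.G) (x : Fin g.1.1 → X), (∀ k, 0 ≤ x k) →
    (D.theta g = 0 → ∀ j k, j ≠ k → x j ⊓ x k = 0) →
    ∀ Φ : PosHom g.1.1 →ₗ[ℝ] X, IsFunctionCalculus x Φ →
      ν (Φ g.1.2) ≤ D.M g * g.1.2.1 (fun k => ν (x k))

/-! ### Banach lattices -/

/-- A (real) Banach lattice: a complete normed space with a compatible lattice order and a solid
norm. -/
class IsBanachLattice (X : Type*) [NormedAddCommGroup X] [NormedSpace ℝ X] [Lattice X] : Prop
    extends IsOrderedAddMonoid X, IsOrderedModule ℝ X, HasSolidNorm X, CompleteSpace X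

/-- A Banach lattice is `𝒟`-convex if its norm is `𝒟`-convex. -/
def IsDConvex (D : ConvexityCondition) (X : Type*) [NormedAddCommGroup X] [NormedSpace ℝ X]
    [Lattice X] [IsBanachLattice X] : Prop :=
  IsDConvexSeminorm D (normSeminorm ℝ X)

/-- `D'.Weaker D` is `𝒟' ≤ 𝒟`: every `𝒟`-convex Banach lattice is `𝒟'`-convex. -/
def ConvexityCondition.Weaker (D' D : ConvexityCondition) : Prop :=
  ∀ (X : Type v) [NormedAddCommGroup X] [NormedSpace ℝ X] [Lattice X] [IsBanachLattice X],
    IsDConvex D X → IsDConvex D' X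

/-! ### Quotients of Banach lattices by closed ideals -/

/-- A closed (order) ideal of a Banach lattice: a closed solid linear subspace. -/
structure ClosedIdeal (X : Type*) [NormedAddCommGroup X] [NormedSpace ℝ X] [Lattice X] extends
    Submodule ℝ X where
  isClosed : IsClosed carrier
  solid : ∀ x y : X, |x| ≤ |y| → y ∈ carrier → x ∈ carrier

namespace ClosedIdeal

variable {X : Type*} [NormedAddCommGroup X] [NormedSpace ℝ X] [Lattice X]

/-- The quotient `X/J`, with the quotient norm and the quotient order. -/
def Quot (J : ClosedIdeal X) : Type _ := X ⧸ J.toSubmodule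

instance (J : ClosedIdeal X) : NormedAddCommGroup J.Quot :=
  haveI : IsClosed (J.toSubmodule : Set X) := J.isClosed
  inferInstanceAs (NormedAddCommGroup (X ⧸ J.toSubmodule))

instance (J : ClosedIdeal X) : NormedSpace ℝ J.Quot :=
  inferInstanceAs (NormedSpace ℝ (X ⧸ J.toSubmodule))

/-- The quotient homomorphism `X → X/J`. -/
def mkQ (J : ClosedIdeal X) : X →L[ℝ] J.Quot := J.toSubmodule.mkQL


variable (J : ClosedIdeal X)

theorem mkQ_surjective : Function.Surjective J.mkQ := J.toSubmodule.mkQ_surjective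

theorem mkQ_eq_iff {x y : X} : J.mkQ x = J.mkQ y ↔ x - y ∈ J.toSubmodule :=
  Submodule.Quotient.eq J.toSubmodule

theorem norm_mkQ_le (x : X) : ‖J.mkQ x‖ ≤ ‖x‖ := Submodule.Quotient.norm_mk_le J.toSubmodule x

theorem exists_norm_lt (q : J.Quot) {ε : ℝ} (hε : 0 < ε) :
    ∃ x : X, J.mkQ x = q ∧ ‖x‖ < ‖q‖ + ε := Submodule.Quotient.norm_mk_lt (S := J.toSubmodule) q hε

variable [IsBanachLattice X]

theorem mem_of_abs_le {x a b : X} (ha : a ∈ J.toSubmodule) (hb : b ∈ J.toSubmodule)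
    (h : |x| ≤ |a| + |b|) : x ∈ J.toSubmodule := by
  have ha' : |a| ∈ J.toSubmodule := J.solid _ a (abs_abs a).le ha
  have hb' : |b| ∈ J.toSubmodule := J.solid _ b (abs_abs b).le hb
  exact J.solid _ _ (h.trans (le_abs_self _)) (J.toSubmodule.add_mem ha' hb')

theorem mkQ_sup_congr {a b c d : X} (h₁ : J.mkQ a = J.mkQ c) (h₂ : J.mkQ b = J.mkQ d) :
    J.mkQ (a ⊔ b) = J.mkQ (c ⊔ d) := by
  rw [mkQ_eq_iff] at *
  refine J.mem_of_abs_le h₁ h₂ ?_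
  calc |a ⊔ b - c ⊔ d| = |a ⊔ b - c ⊔ b + (c ⊔ b - c ⊔ d)| := by rw [sub_add_sub_cancel]
    _ ≤ |a ⊔ b - c ⊔ b| + |c ⊔ b - c ⊔ d| := abs_add_le _ _
    _ ≤ |a - c| + |b - d| := by
      refine add_le_add (abs_sup_sub_sup_le_abs _ _ _) ?_
      rw [sup_comm c, sup_comm c]
      exact abs_sup_sub_sup_le_abs _ _ _

theorem mkQ_inf_congr {a b c d : X} (h₁ : J.mkQ a = J.mkQ c) (h₂ : J.mkQ b = J.mkQ d) :
    J.mkQ (a ⊓ b) = J.mkQ (c ⊓ d) := by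
  rw [mkQ_eq_iff] at *
  refine J.mem_of_abs_le h₁ h₂ ?_
  calc |a ⊓ b - c ⊓ d| = |a ⊓ b - c ⊓ b + (c ⊓ b - c ⊓ d)| := by rw [sub_add_sub_cancel]
    _ ≤ |a ⊓ b - c ⊓ b| + |c ⊓ b - c ⊓ d| := abs_add_le _ _
    _ ≤ |a - c| + |b - d| := by
      refine add_le_add (abs_inf_sub_inf_le_abs _ _ _) ?_
      rw [inf_comm c, inf_comm c]
      exact abs_inf_sub_inf_le_abs _ _ _

/-- The supremum in `X/J`, computed on representatives. -/
def supOp (p q : J.Quot) : J.Quot :=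
  J.mkQ (Function.surjInv J.mkQ_surjective p ⊔ Function.surjInv J.mkQ_surjective q)

/-- The infimum in `X/J`, computed on representatives. -/
def infOp (p q : J.Quot) : J.Quot :=
  J.mkQ (Function.surjInv J.mkQ_surjective p ⊓ Function.surjInv J.mkQ_surjective q)

theorem supOp_mkQ (x y : X) : J.supOp (J.mkQ x) (J.mkQ y) = J.mkQ (x ⊔ y) :=
  J.mkQ_sup_congr (Function.surjInv_eq J.mkQ_surjective _) (Function.surjInv_eq J.mkQ_surjective _)

theorem infOp_mkQ (x y : X) : J.infOp (J.mkQ x) (J.mkQ y) = J.mkQ (x ⊓ y) :=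
  J.mkQ_inf_congr (Function.surjInv_eq J.mkQ_surjective _) (Function.surjInv_eq J.mkQ_surjective _)

/-- The quotient lattice structure, for which the quotient map is a lattice homomorphism; the order
is given by `p ≤ q ↔ p ⊔ q = q`. -/
instance : Lattice J.Quot :=
  @Lattice.mk' _ ⟨J.supOp⟩ ⟨J.infOp⟩
    (by
      intro a b
      obtain ⟨a, rfl⟩ := J.mkQ_surjective a
      obtain ⟨b, rfl⟩ := J.mkQ_surjective b
      change J.supOp _ _ = J.supOp _ _
      simp only [supOp_mkQ, sup_comm])
    (by
      intro a b c
      obtain ⟨a, rfl⟩ := J.mkQ_surjective a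
      obtain ⟨b, rfl⟩ := J.mkQ_surjective b
      obtain ⟨c, rfl⟩ := J.mkQ_surjective c
      change J.supOp (J.supOp _ _) _ = J.supOp _ (J.supOp _ _)
      simp only [supOp_mkQ, sup_assoc])
    (by
      intro a b
      obtain ⟨a, rfl⟩ := J.mkQ_surjective a
      obtain ⟨b, rfl⟩ := J.mkQ_surjective b
      change J.infOp _ _ = J.infOp _ _
      simp only [infOp_mkQ, inf_comm])
    (by
      intro a b c
      obtain ⟨a, rfl⟩ := J.mkQ_surjective a
      obtain ⟨b, rfl⟩ := J.mkQ_surjective b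
      obtain ⟨c, rfl⟩ := J.mkQ_surjective c
      change J.infOp (J.infOp _ _) _ = J.infOp _ (J.infOp _ _)
      simp only [infOp_mkQ, inf_assoc])
    (by
      intro a b
      obtain ⟨a, rfl⟩ := J.mkQ_surjective a
      obtain ⟨b, rfl⟩ := J.mkQ_surjective b
      change J.supOp _ (J.infOp _ _) = _
      simp only [infOp_mkQ, supOp_mkQ, sup_inf_self])
    (by
      intro a b
      obtain ⟨a, rfl⟩ := J.mkQ_surjective a
      obtain ⟨b, rfl⟩ := J.mkQ_surjective b
      change J.infOp _ (J.supOp _ _) = _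
      simp only [infOp_mkQ, supOp_mkQ, inf_sup_self])

theorem mkQ_sup (x y : X) : J.mkQ (x ⊔ y) = J.mkQ x ⊔ J.mkQ y := (J.supOp_mkQ x y).symm

theorem mkQ_inf (x y : X) : J.mkQ (x ⊓ y) = J.mkQ x ⊓ J.mkQ y := (J.infOp_mkQ x y).symm

theorem mkQ_mono {x y : X} (h : x ≤ y) : J.mkQ x ≤ J.mkQ y := by
  rw [← sup_eq_right, ← mkQ_sup, sup_eq_right.2 h]

theorem exists_le_of_le {p q : J.Quot} (h : p ≤ q) :
    ∃ x y : X, x ≤ y ∧ J.mkQ x = p ∧ J.mkQ y = q := by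
  obtain ⟨x, rfl⟩ := J.mkQ_surjective p
  obtain ⟨y, rfl⟩ := J.mkQ_surjective q
  exact ⟨x, x ⊔ y, le_sup_left, rfl, by rw [mkQ_sup, sup_eq_right.2 h]⟩

instance : IsOrderedAddMonoid J.Quot where
  add_le_add_left := by
    intro p q h r
    obtain ⟨x, y, hxy, rfl, rfl⟩ := J.exists_le_of_le h
    obtain ⟨z, rfl⟩ := J.mkQ_surjective r
    rw [← map_add, ← map_add]
    exact J.mkQ_mono (by gcongr)

theorem mkQ_abs (x : X) : J.mkQ |x| = |J.mkQ x| := by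
  rw [abs, abs, mkQ_sup, map_neg]

/-- The quotient of a Banach lattice by a closed ideal is a Banach lattice. -/
instance : IsBanachLattice J.Quot where
  smul_le_smul_of_nonneg_left := by
    intro r hr p q h
    obtain ⟨x, y, hxy, rfl, rfl⟩ := J.exists_le_of_le h
    rw [← map_smul, ← map_smul]
    exact J.mkQ_mono (smul_le_smul_of_nonneg_left hxy hr)
  smul_le_smul_of_nonneg_right := by
    intro p hp r s h
    obtain ⟨x, y, hxy, hx, rfl⟩ := J.exists_le_of_le hp
    have h0 : J.mkQ (y - x) = J.mkQ y := by rw [map_sub, hx, sub_zero]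
    rw [← h0, ← map_smul, ← map_smul]
    exact J.mkQ_mono (smul_le_smul_of_nonneg_right h (sub_nonneg.2 hxy))
  solid := by
    intro p q h
    obtain ⟨x, rfl⟩ := J.mkQ_surjective p
    refine le_of_forall_pos_lt_add fun ε hε => ?_
    obtain ⟨y, rfl, hy⟩ := J.exists_norm_lt q hε
    have hw : J.mkQ ((x ⊓ |y|) ⊔ -|y|) = J.mkQ x := by
      rw [mkQ_sup, mkQ_inf, map_neg, mkQ_abs]
      rw [inf_eq_left.2 ((le_abs_self _).trans h), sup_eq_left]
      exact (neg_le_neg h).trans (neg_le.1 (neg_le_abs _))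
    have hw' : abs ((x ⊓ |y|) ⊔ -|y|) ≤ |y| := by
      refine abs_le'.2 ⟨sup_le inf_le_right ?_, ?_⟩
      · exact (neg_nonpos.2 (abs_nonneg y)).trans (abs_nonneg y)
      · exact neg_le.1 le_sup_right
    rw [← hw]
    exact ((J.norm_mkQ_le _).trans (norm_le_norm_of_abs_le_abs hw')).trans_lt hy
  toCompleteSpace := inferInstanceAs (CompleteSpace (X ⧸ J.toSubmodule))

end ClosedIdeal

/-! ### The free `𝒟`-convex Banach lattice over a Banach space -/

section Free

variable (E : Type u) [NormedAddCommGroup E] [NormedSpace ℝ E]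

/-- The closed unit ball `B_{E*}` of the dual space. -/
abbrev DualBall : Type u := Metric.closedBall (0 : StrongDual ℝ E) 1

variable {E}

/-- The point evaluation `δ_x : B_{E*} → ℝ`. -/
def pointEval (x : E) : DualBall E → ℝ := fun φ => φ.1 x

/-- The function `h(δ_{x_1}, …, δ_{x_m})`, defined pointwise. -/
def evalComp {m : ℕ} (h : PosHom m) (x : Fin m → E) : DualBall E → ℝ :=
  fun φ => h.1 (fun k => pointEval (x k) φ)

/-- Precomposition of `h ∈ ℋ_m` with a selection of `m` of `n` coordinates. -/
def PosHom.reindex {m n : ℕ} (σ : Fin m → Fin n) (h : PosHom m) : PosHom n :=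
  ⟨fun t => h.1 (t ∘ σ), h.2.1.comp (by fun_prop), fun r t hr => h.2.2 r (t ∘ σ) hr⟩

/-- Two functions of this form can be written with the same tuple. -/
theorem exists_common {m n : ℕ} (h : PosHom m) (x : Fin m → E) (k : PosHom n) (y : Fin n → E) :
    ∃ (h' k' : PosHom (m + n)) (z : Fin (m + n) → E),
      evalComp h x = evalComp h' z ∧ evalComp k y = evalComp k' z := by
  refine ⟨PosHom.reindex (Fin.castAdd n) h, PosHom.reindex (Fin.natAdd m) k, Fin.append x y, ?_, ?_⟩
  · funext φ
    simp [evalComp, PosHom.reindex, Function.comp_def]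
  · funext φ
    simp [evalComp, PosHom.reindex, Function.comp_def]

variable (E)

/-- The vector lattice `Y₀ = {h(δ_{x_1}, …, δ_{x_m})}` of functions on `B_{E*}`. -/
def evalSpace : Submodule ℝ (DualBall E → ℝ) where
  carrier := {f | ∃ (m : ℕ) (h : PosHom m) (x : Fin m → E), f = evalComp h x}
  add_mem' := by
    rintro _ _ ⟨m, h, x, rfl⟩ ⟨n, k, y, rfl⟩
    obtain ⟨h', k', z, e₁, e₂⟩ := exists_common h x k y
    exact ⟨_, h' + k', z, by rw [e₁, e₂]; rfl⟩
  zero_mem' := ⟨0, 0, Fin.elim0, rfl⟩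
  smul_mem' := by
    rintro c _ ⟨m, h, x, rfl⟩
    exact ⟨m, c • h, x, rfl⟩

/-- The space `Y₀` as a type of its own, which will carry the free `𝒟`-convex norm. -/
def PreFBL (_D : ConvexityCondition) : Type u := evalSpace E

namespace PreFBL

variable (D : ConvexityCondition)

instance : AddCommGroup (PreFBL E D) := inferInstanceAs (AddCommGroup (evalSpace E))

instance : Module ℝ (PreFBL E D) := inferInstanceAs (Module ℝ (evalSpace E))

variable {E D}

/-- An element of `Y₀` as a function on `B_{E*}`. -/
def toFun (f : PreFBL E D) : DualBall E → ℝ := f.1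

theorem toFun_injective : Function.Injective (toFun : PreFBL E D → DualBall E → ℝ) :=
  Subtype.val_injective

instance : Max (PreFBL E D) :=
  ⟨fun f g => ⟨f.toFun ⊔ g.toFun, by
    obtain ⟨m, h, x, e₁⟩ := f.2
    obtain ⟨n, k, y, e₂⟩ := g.2
    obtain ⟨h', k', z, e₁', e₂'⟩ := exists_common h x k y
    exact ⟨_, h' ⊔ k', z, by rw [toFun, toFun, e₁, e₂, e₁', e₂']; rfl⟩⟩⟩

instance : Min (PreFBL E D) :=
  ⟨fun f g => ⟨f.toFun ⊓ g.toFun, by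
    obtain ⟨m, h, x, e₁⟩ := f.2
    obtain ⟨n, k, y, e₂⟩ := g.2
    obtain ⟨h', k', z, e₁', e₂'⟩ := exists_common h x k y
    exact ⟨_, h' ⊓ k', z, by rw [toFun, toFun, e₁, e₂, e₁', e₂']; rfl⟩⟩⟩

instance : LE (PreFBL E D) := ⟨fun f g => f.toFun ≤ g.toFun⟩

instance : LT (PreFBL E D) := ⟨fun f g => f.toFun < g.toFun⟩

/-- The pointwise lattice structure. -/
instance : Lattice (PreFBL E D) :=
  Function.Injective.lattice toFun toFun_injective
    Iff.rfl Iff.rfl (fun _ _ => rfl) (fun _ _ => rfl)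

instance : IsOrderedAddMonoid (PreFBL E D) where
  add_le_add_left := by
    intro f g h k φ
    exact add_le_add_left (h φ) (k.toFun φ)

instance : IsOrderedModule ℝ (PreFBL E D) where
  smul_le_smul_of_nonneg_left := by
    intro r hr f g h φ
    exact mul_le_mul_of_nonneg_left (h φ) hr
  smul_le_smul_of_nonneg_right := by
    intro f hf r s h φ
    exact mul_le_mul_of_nonneg_right h (hf φ)

/-- The point evaluation `δ_x` as an element of `Y₀`. -/
def delta (x : E) : PreFBL E D :=
  ⟨pointEval x, 1, PosHom.proj 0, fun _ => x, rfl⟩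

variable (E D)

/-- The set `𝒩_𝒟` of all `𝒟`-convex lattice seminorms `ν` on `Y₀` with `ν(δ_x) ≤ ‖x‖` for all `x`. -/
def admissible : Set (Seminorm ℝ (PreFBL E D)) :=
  {ν | IsLatticeSeminorm ν ∧ IsDConvexSeminorm D ν ∧ ∀ x : E, ν (delta x) ≤ ‖x‖}

/-- The free `𝒟`-convex (semi)norm, the supremum of all `ν ∈ 𝒩_𝒟`. -/
def freeSeminorm : Seminorm ℝ (PreFBL E D) := sSup (admissible E D)

variable {E D}

theorem toFun_sum {ι : Type*} (s : Finset ι) (f : ι → PreFBL E D) (φ : DualBall E) :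
    (∑ i ∈ s, f i).toFun φ = ∑ i ∈ s, (f i).toFun φ := by
  classical
  induction s using Finset.induction_on with
  | empty => simp; rfl
  | insert a s ha ih =>
    rw [Finset.sum_insert ha, Finset.sum_insert ha, ← ih]
    rfl

theorem exists_abs_le (f : PreFBL E D) :
    ∃ (m : ℕ) (C : ℝ) (x : Fin m → E), 0 ≤ C ∧ |f| ≤ abs (C • ∑ k, |(delta (x k) : PreFBL E D)|) := by
  obtain ⟨m, h, x, e⟩ := f.2
  obtain ⟨C, hC, hb⟩ := PosHom.exists_bound h
  refine ⟨m, C, x, hC, le_trans ?_ (le_abs_self _)⟩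
  intro φ
  have e' : |f|.toFun φ = |h.1 fun k => pointEval (x k) φ| := by
    change |f.toFun φ| = _
    rw [toFun, e]
    rfl
  have e'' : (C • ∑ k, |(delta (x k) : PreFBL E D)|).toFun φ = C * ∑ k, |pointEval (x k) φ| := by
    change C * (∑ k, |(delta (x k) : PreFBL E D)|).toFun φ = _
    rw [toFun_sum]
    rfl
  rw [e', e'']
  refine (hb _).trans (mul_le_mul_of_nonneg_left ?_ hC)
  refine (pi_norm_le_iff_of_nonneg (Finset.sum_nonneg fun _ _ => abs_nonneg _)).2 fun k => ?_
  exact Finset.single_le_sum (f := fun k => |pointEval (x k) φ|) (fun _ _ => abs_nonneg _)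
    (Finset.mem_univ k)

variable (E D)

/-- The supremum which defines the free norm is finite. -/
theorem bddAbove_admissible : BddAbove (admissible E D) := by
  rw [Seminorm.bddAbove_iff]
  have key : ∀ f : PreFBL E D, ∃ B : ℝ, ∀ ν ∈ admissible E D, ν f ≤ B := by
    intro f
    obtain ⟨m, C, x, hC, hf⟩ := exists_abs_le f
    refine ⟨C * ∑ k, ‖x k‖, fun ν hν => (hν.1 _ _ hf).trans ?_⟩
    rw [map_smul_eq_mul, Real.norm_of_nonneg hC]
    refine mul_le_mul_of_nonneg_left ?_ hC
    refine (Finset.le_sum_of_subadditive ν (map_zero ν).le (map_add_le_add ν) _ _).trans (Finset.sum_le_sum fun k _ => ?_)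
    exact (hν.1 _ _ (abs_abs _).le).trans (hν.2.2 (x k))
  choose B hB using key
  refine ⟨B, ?_⟩
  rintro _ ⟨ν, hν, rfl⟩ f
  exact hB f ν hν

variable {E D}

theorem freeSeminorm_apply (f : PreFBL E D) :
    freeSeminorm E D f = ⨆ ν : admissible E D, ν.1 f :=
  Seminorm.sSup_apply (bddAbove_admissible E D)

theorem freeSeminorm_solid : IsLatticeSeminorm (freeSeminorm E D) := by
  intro f g h
  rw [freeSeminorm_apply, freeSeminorm_apply]
  refine ciSup_mono ?_ fun ν => ν.2.1 f g h
  obtain ⟨B, hB⟩ := Seminorm.bddAbove_iff.1 (bddAbove_admissible E D)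
  exact ⟨B g, by rintro _ ⟨ν, rfl⟩; exact hB ⟨ν.1, ν.2, rfl⟩ g⟩

instance : SeminormedAddCommGroup (PreFBL E D) :=
  (freeSeminorm E D).toAddGroupSeminorm.toSeminormedAddCommGroup

theorem norm_def (f : PreFBL E D) : ‖f‖ = freeSeminorm E D f := rfl

instance : NormedSpace ℝ (PreFBL E D) where
  norm_smul_le r f := (map_smul_eq_mul (freeSeminorm E D) r f).le

theorem norm_le_of_abs_le {f g : PreFBL E D} (h : |f| ≤ |g|) : ‖f‖ ≤ ‖g‖ :=
  freeSeminorm_solid f g h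

theorem norm_abs (f : PreFBL E D) : ‖|f|‖ = ‖f‖ :=
  le_antisymm (norm_le_of_abs_le (abs_abs f).le) (norm_le_of_abs_le (abs_abs f).ge)

theorem norm_le_add {f g h : PreFBL E D} (H : |f| ≤ |g| + |h|) : ‖f‖ ≤ ‖g‖ + ‖h‖ := by
  rw [← norm_abs g, ← norm_abs h]
  exact (norm_le_of_abs_le (H.trans (le_abs_self _))).trans (norm_add_le _ _)

theorem norm_sup_sub_sup_le (a b c d : PreFBL E D) : ‖a ⊔ b - c ⊔ d‖ ≤ ‖a - c‖ + ‖b - d‖ := by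
  refine norm_le_add ?_
  calc |a ⊔ b - c ⊔ d| = |a ⊔ b - c ⊔ b + (c ⊔ b - c ⊔ d)| := by rw [sub_add_sub_cancel]
    _ ≤ |a ⊔ b - c ⊔ b| + |c ⊔ b - c ⊔ d| := abs_add_le _ _
    _ ≤ |a - c| + |b - d| := by
      refine add_le_add (abs_sup_sub_sup_le_abs _ _ _) ?_
      rw [sup_comm c, sup_comm c]
      exact abs_sup_sub_sup_le_abs _ _ _

theorem norm_inf_sub_inf_le (a b c d : PreFBL E D) : ‖a ⊓ b - c ⊓ d‖ ≤ ‖a - c‖ + ‖b - d‖ := by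
  refine norm_le_add ?_
  calc |a ⊓ b - c ⊓ d| = |a ⊓ b - c ⊓ b + (c ⊓ b - c ⊓ d)| := by rw [sub_add_sub_cancel]
    _ ≤ |a ⊓ b - c ⊓ b| + |c ⊓ b - c ⊓ d| := abs_add_le _ _
    _ ≤ |a - c| + |b - d| := by
      refine add_le_add (abs_inf_sub_inf_le_abs _ _ _) ?_
      rw [inf_comm c, inf_comm c]
      exact abs_inf_sub_inf_le_abs _ _ _

theorem uniformContinuous₂_of_le (op : PreFBL E D → PreFBL E D → PreFBL E D)
    (h : ∀ a b c d, ‖op a b - op c d‖ ≤ ‖a - c‖ + ‖b - d‖) : UniformContinuous₂ op := by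
  rw [uniformContinuous₂_def]
  refine Metric.uniformContinuous_iff.2 fun ε hε => ⟨ε / 2, half_pos hε, ?_⟩
  rintro ⟨a, b⟩ ⟨c, d⟩ hd
  rw [Prod.dist_eq, max_lt_iff, dist_eq_norm, dist_eq_norm] at hd
  rw [dist_eq_norm]
  refine (h a b c d).trans_lt ?_
  have h₁ : ‖a - c‖ < ε / 2 := hd.1
  have h₂ : ‖b - d‖ < ε / 2 := hd.2
  linarith

theorem uniformContinuous₂_sup : UniformContinuous₂ (fun a b : PreFBL E D => a ⊔ b) :=
  uniformContinuous₂_of_le _ norm_sup_sub_sup_le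

theorem uniformContinuous₂_inf : UniformContinuous₂ (fun a b : PreFBL E D => a ⊓ b) :=
  uniformContinuous₂_of_le _ norm_inf_sub_inf_le

end PreFBL

open UniformSpace

variable (D : ConvexityCondition)

/-- The free `𝒟`-convex Banach lattice `FBL^𝒟[E]`: the completion of `Y₀` with respect to the
largest `𝒟`-convex lattice seminorm `ν` with `ν(δ_x) ≤ ‖x‖`; the lattice operations are the
continuous extensions of those of `Y₀`. -/
def FBL : Type u := Completion (PreFBL E D)

namespace FBL

instance : NormedAddCommGroup (FBL E D) :=
  inferInstanceAs (NormedAddCommGroup (Completion (PreFBL E D)))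

instance : NormedSpace ℝ (FBL E D) :=
  inferInstanceAs (NormedSpace ℝ (Completion (PreFBL E D)))

instance : CompleteSpace (FBL E D) :=
  inferInstanceAs (CompleteSpace (Completion (PreFBL E D)))

variable {E D}

/-- The canonical map of `Y₀` onto a dense subspace of its completion. -/
def incl : PreFBL E D →L[ℝ] FBL E D := Completion.toComplL

theorem denseRange_incl : DenseRange (incl : PreFBL E D → FBL E D) := Completion.denseRange_coe

theorem norm_incl (f : PreFBL E D) : ‖(incl f : FBL E D)‖ = ‖f‖ := Completion.norm_coe f

/-- The canonical embedding `φ_E : E → FBL^𝒟[E]`, `x ↦ δ_x`. -/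
def embed : E →ₗ[ℝ] FBL E D where
  toFun x := incl (PreFBL.delta x)
  map_add' x y := by
    rw [← map_add]
    congr 1
    exact PreFBL.toFun_injective (funext fun φ => map_add φ.1 x y)
  map_smul' c x := by
    rw [RingHom.id_apply, ← map_smul]
    congr 1
    exact PreFBL.toFun_injective (funext fun φ => map_smul φ.1 c x)

/-- The continuous extension of the supremum of `Y₀`. -/
def supOp : FBL E D → FBL E D → FBL E D := Completion.map₂ (fun a b : PreFBL E D => a ⊔ b)

/-- The continuous extension of the infimum of `Y₀`. -/
def infOp : FBL E D → FBL E D → FBL E D := Completion.map₂ (fun a b : PreFBL E D => a ⊓ b)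

theorem supOp_incl (a b : PreFBL E D) : supOp (incl a) (incl b) = incl (a ⊔ b) :=
  Completion.map₂_coe_coe a b _ PreFBL.uniformContinuous₂_sup

theorem infOp_incl (a b : PreFBL E D) : infOp (incl a) (incl b) = incl (a ⊓ b) :=
  Completion.map₂_coe_coe a b _ PreFBL.uniformContinuous₂_inf

theorem continuous_supOp : Continuous fun p : FBL E D × FBL E D => supOp p.1 p.2 :=
  (Completion.uniformContinuous_map₂ (fun a b : PreFBL E D => a ⊔ b)).continuous

theorem continuous_infOp : Continuous fun p : FBL E D × FBL E D => infOp p.1 p.2 :=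
  (Completion.uniformContinuous_map₂ (fun a b : PreFBL E D => a ⊓ b)).continuous

theorem continuous_supOp₂ {Z : Type*} [TopologicalSpace Z] {f g : Z → FBL E D} (hf : Continuous f)
    (hg : Continuous g) : Continuous fun z => supOp (f z) (g z) :=
  continuous_supOp.comp (hf.prodMk hg)

theorem continuous_infOp₂ {Z : Type*} [TopologicalSpace Z] {f g : Z → FBL E D} (hf : Continuous f)
    (hg : Continuous g) : Continuous fun z => infOp (f z) (g z) :=
  continuous_infOp.comp (hf.prodMk hg)

theorem induction₁ {p : FBL E D → Prop} (hp : IsClosed {a | p a}) (h : ∀ a, p (incl a))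
    (a : FBL E D) : p a :=
  denseRange_incl.induction_on a hp h

theorem induction₂ {p : FBL E D → FBL E D → Prop} (hp : IsClosed {q : FBL E D × FBL E D | p q.1 q.2})
    (h : ∀ a b, p (incl a) (incl b)) (a b : FBL E D) : p a b :=
  denseRange_incl.induction_on₂ hp h a b

theorem induction₃ {p : FBL E D → FBL E D → FBL E D → Prop}
    (hp : IsClosed {q : FBL E D × FBL E D × FBL E D | p q.1 q.2.1 q.2.2})
    (h : ∀ a b c, p (incl a) (incl b) (incl c)) (a b c : FBL E D) : p a b c :=
  denseRange_incl.induction_on₃ hp h a b c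

theorem supOp_comm : ∀ a b : FBL E D, supOp a b = supOp b a :=
  induction₂ (isClosed_eq (continuous_supOp₂ continuous_fst continuous_snd)
      (continuous_supOp₂ continuous_snd continuous_fst))
    fun a b => by simp only [supOp_incl, sup_comm]

theorem infOp_comm : ∀ a b : FBL E D, infOp a b = infOp b a :=
  induction₂ (isClosed_eq (continuous_infOp₂ continuous_fst continuous_snd)
      (continuous_infOp₂ continuous_snd continuous_fst))
    fun a b => by simp only [infOp_incl, inf_comm]

theorem supOp_assoc : ∀ a b c : FBL E D, supOp (supOp a b) c = supOp a (supOp b c) :=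
  induction₃ (isClosed_eq
      (continuous_supOp₂ (continuous_supOp₂ continuous_fst continuous_snd.fst) continuous_snd.snd)
      (continuous_supOp₂ continuous_fst (continuous_supOp₂ continuous_snd.fst continuous_snd.snd)))
    fun a b c => by simp only [supOp_incl, sup_assoc]

theorem infOp_assoc : ∀ a b c : FBL E D, infOp (infOp a b) c = infOp a (infOp b c) :=
  induction₃ (isClosed_eq
      (continuous_infOp₂ (continuous_infOp₂ continuous_fst continuous_snd.fst) continuous_snd.snd)
      (continuous_infOp₂ continuous_fst (continuous_infOp₂ continuous_snd.fst continuous_snd.snd)))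
    fun a b c => by simp only [infOp_incl, inf_assoc]

theorem supOp_infOp_self : ∀ a b : FBL E D, supOp a (infOp a b) = a :=
  induction₂ (isClosed_eq (continuous_supOp₂ continuous_fst
      (continuous_infOp₂ continuous_fst continuous_snd)) continuous_fst)
    fun a b => by simp only [supOp_incl, infOp_incl, sup_inf_self]

theorem infOp_supOp_self : ∀ a b : FBL E D, infOp a (supOp a b) = a :=
  induction₂ (isClosed_eq (continuous_infOp₂ continuous_fst
      (continuous_supOp₂ continuous_fst continuous_snd)) continuous_fst)
    fun a b => by simp only [supOp_incl, infOp_incl, inf_sup_self]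

/-- The lattice structure of the completion: `a ≤ b` if and only if `a ⊔ b = b`. -/
instance : Lattice (FBL E D) :=
  @Lattice.mk' _ ⟨supOp⟩ ⟨infOp⟩ supOp_comm supOp_assoc infOp_comm infOp_assoc supOp_infOp_self
    infOp_supOp_self

theorem incl_sup (a b : PreFBL E D) : (incl (a ⊔ b) : FBL E D) = incl a ⊔ incl b :=
  (supOp_incl a b).symm

theorem incl_inf (a b : PreFBL E D) : (incl (a ⊓ b) : FBL E D) = incl a ⊓ incl b :=
  (infOp_incl a b).symm

instance : ContinuousSup (FBL E D) := ⟨continuous_supOp⟩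

instance : ContinuousInf (FBL E D) := ⟨continuous_infOp⟩

theorem add_sup' (a b c : FBL E D) : (a ⊔ b) + c = (a + c) ⊔ (b + c) :=
  induction₃ (p := fun a b c => (a ⊔ b) + c = (a + c) ⊔ (b + c))
    (isClosed_eq (by fun_prop) (by fun_prop))
    (fun a b c => by simp only [← incl_sup, ← map_add, sup_add]) a b c

theorem smul_sup' {r : ℝ} (hr : 0 ≤ r) (a b : FBL E D) : r • (a ⊔ b) = (r • a) ⊔ (r • b) :=
  induction₂ (p := fun a b => r • (a ⊔ b) = (r • a) ⊔ (r • b))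
    (isClosed_eq ((continuous_fst.sup continuous_snd).const_smul r)
      ((continuous_fst.const_smul r).sup (continuous_snd.const_smul r)))
    (fun a b => by
      have h : r • (a ⊔ b) = (r • a) ⊔ (r • b) :=
        PreFBL.toFun_injective (funext fun φ => mul_max_of_nonneg (a.toFun φ) (b.toFun φ) hr)
      rw [← incl_sup, ← map_smul, ← map_smul, ← map_smul, ← incl_sup, h]) a b

instance : IsOrderedAddMonoid (FBL E D) where
  add_le_add_left := by
    intro a b h c
    rw [← sup_eq_right] at h ⊢
    rw [← add_sup', h]

theorem norm_abs' (a : FBL E D) : ‖|a|‖ = ‖a‖ :=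
  induction₁ (p := fun a => ‖a ⊔ -a‖ = ‖a‖)
    (isClosed_eq (by fun_prop) (by fun_prop))
    (fun a => by
      rw [← map_neg, ← incl_sup, norm_incl, norm_incl]
      exact PreFBL.norm_abs a) a

theorem norm_abs_inf_le (a b : FBL E D) : ‖|a| ⊓ |b|‖ ≤ ‖b‖ :=
  induction₂ (p := fun a b => ‖(a ⊔ -a) ⊓ (b ⊔ -b)‖ ≤ ‖b‖)
    (isClosed_le (by fun_prop) (by fun_prop))
    (fun a b => by
      rw [← map_neg, ← map_neg, ← incl_sup, ← incl_sup, ← incl_inf, norm_incl, norm_incl]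
      refine PreFBL.norm_le_of_abs_le ?_
      change abs (|a| ⊓ |b|) ≤ |b|
      rw [abs_of_nonneg (le_inf (abs_nonneg a) (abs_nonneg b))]
      exact inf_le_right) a b

/-- `FBL^𝒟[E]` is a Banach lattice. -/
instance : IsBanachLattice (FBL E D) where
  smul_le_smul_of_nonneg_left := by
    intro r hr a b h
    rw [← sup_eq_right] at h ⊢
    rw [← smul_sup' hr, h]
  smul_le_smul_of_nonneg_right := by
    intro a ha r s h
    have h1 : 0 ≤ (s - r) • a := by
      rw [← sup_eq_right] at ha ⊢
      conv_rhs => rw [← ha, smul_sup' (sub_nonneg.2 h), smul_zero]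
    rwa [sub_smul, sub_nonneg] at h1
  solid := by
    intro a b h
    rw [← norm_abs' a, ← inf_eq_left.2 h]
    exact norm_abs_inf_le a b

end FBL

end Free

/-! ### Projectivity -/

/-- The Banach lattice `P` is projective for `𝒟`-convex Banach lattices. (A lattice homomorphism
between Banach lattices is a bounded linear operator which preserves the lattice operations.) -/
def IsProjectiveFor (D : ConvexityCondition) (P : Type u) [NormedAddCommGroup P] [NormedSpace ℝ P]
    [Lattice P] [IsBanachLattice P] : Prop :=
  ∀ (X : Type v) [NormedAddCommGroup X] [NormedSpace ℝ X] [Lattice X] [IsBanachLattice X],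
    IsDConvex D X → ∀ (J : ClosedIdeal X) (T : P →L[ℝ] J.Quot), PreservesLattice T →
      ∀ ε : ℝ, 0 < ε → ∃ S : P →L[ℝ] X, PreservesLattice S ∧
        J.mkQ.comp S = T ∧ ‖S‖ ≤ (1 + ε) * ‖T‖

/-- The Banach space `E` is linearly projective for `𝒟`-convex Banach lattices. -/
def IsLinearlyProjectiveFor (D : ConvexityCondition) (E : Type u) [NormedAddCommGroup E]
    [NormedSpace ℝ E] : Prop :=
  ∀ (X : Type v) [NormedAddCommGroup X] [NormedSpace ℝ X] [Lattice X] [IsBanachLattice X],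
    IsDConvex D X → ∀ (J : ClosedIdeal X) (T : E →L[ℝ] J.Quot),
      ∀ ε : ℝ, 0 < ε → ∃ S : E →L[ℝ] X, J.mkQ.comp S = T ∧ ‖S‖ ≤ (1 + ε) * ‖T‖

end

noncomputable section

/-! ### Sublattices of vector lattices -/

section VectorLattice

variable {V : Type*} [AddCommGroup V] [Lattice V]

section

variable [Module ℝ V] [IsOrderedModule ℝ V]

/-! Two facts give the equivalence. First, `FBL^{𝒟'}[E]` has a universal property: an operator `S`
from `E` to a `𝒟'`-convex Banach lattice extends to a lattice homomorphism of norm at most `‖S‖`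
(`FBL.exists_extension`), and such extensions are unique (`FBL.latticeHom_ext`). Second, quotients
by closed ideals inherit `𝒟'`-convexity (`ClosedIdeal.isDConvex_quot`). To lift a lattice
homomorphism on the free lattice, restrict it to `E`, lift linearly, extend again; uniqueness shows
that the result is a lift. Conversely, extend an operator `E → X/J` to the free lattice, lift it
linearly, and restrict to `E`. Norms are controlled because the embedding of `E` is contractive.

The extension is first built on `Y₀`, as a graph: take the vector sublattice of `Y₀ × X` generated
by the pairs `(δ_x, S x)`. By Hahn–Banach, if the minimum of finitely many `δ_x` is nonpositive on
the dual ball, then `0` lies in the convex hull of these `x`, so the infimum of the `S x` is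
nonpositive; hence order relations in the first coordinate pass to the second. A lattice version of
Stone–Weierstrass makes the first coordinates relatively uniformly dense in `Y₀`, and completeness
of `X` then makes the relatively uniform closure the graph of a lattice homomorphism `T`. Its norm
bound is immediate from the definition of the free norm, since `c⁻¹ ‖T ·‖` is an admissible seminorm
for every `c > ‖S‖`.

For quotients, positive (disjoint) tuples lift to positive (disjoint) tuples of almost the same
norms. Existence and uniqueness of the function calculus, obtained from the same extension and
density results, transport the inequality for `g`. -/

theorem smul_sup_of_pos {c : ℝ} (hc : 0 < c) (a b : V) : c • (a ⊔ b) = c • a ⊔ c • b :=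
  map_sup (OrderIso.smulRight hc) a b

theorem smul_inf_of_pos {c : ℝ} (hc : 0 < c) (a b : V) : c • (a ⊓ b) = c • a ⊓ c • b :=
  map_inf (OrderIso.smulRight hc) a b

theorem abs_smul_le_smul_abs (c : ℝ) (a : V) : |c • a| ≤ |c| • |a| := by
  rcases le_total 0 c with hc | hc
  · rw [abs_of_nonneg hc]
    refine abs_le'.2 ⟨smul_le_smul_of_nonneg_left (le_abs_self a) hc, ?_⟩
    rw [← smul_neg]
    exact smul_le_smul_of_nonneg_left (neg_le_abs a) hc
  · rw [abs_of_nonpos hc]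
    have hc' : 0 ≤ -c := neg_nonneg.2 hc
    refine abs_le'.2 ⟨?_, ?_⟩
    · rw [← neg_smul_neg]
      exact smul_le_smul_of_nonneg_left (neg_le_abs a) hc'
    · rw [← neg_smul]
      exact smul_le_smul_of_nonneg_left (le_abs_self a) hc'

end

variable [IsOrderedAddMonoid V]

theorem abs_sup_sub_sup_le_add (a b c d : V) : |a ⊔ b - c ⊔ d| ≤ |a - c| + |b - d| := by
  calc |a ⊔ b - c ⊔ d| = |a ⊔ b - c ⊔ b + (c ⊔ b - c ⊔ d)| := by rw [sub_add_sub_cancel]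
    _ ≤ |a ⊔ b - c ⊔ b| + |c ⊔ b - c ⊔ d| := abs_add_le _ _
    _ ≤ |a - c| + |b - d| := by
      refine add_le_add (abs_sup_sub_sup_le_abs _ _ _) ?_
      rw [sup_comm c, sup_comm c]
      exact abs_sup_sub_sup_le_abs _ _ _

theorem abs_inf_sub_inf_le_add (a b c d : V) : |a ⊓ b - c ⊓ d| ≤ |a - c| + |b - d| := by
  calc |a ⊓ b - c ⊓ d| = |a ⊓ b - c ⊓ b + (c ⊓ b - c ⊓ d)| := by rw [sub_add_sub_cancel]
    _ ≤ |a ⊓ b - c ⊓ b| + |c ⊓ b - c ⊓ d| := abs_add_le _ _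
    _ ≤ |a - c| + |b - d| := by
      refine add_le_add (abs_inf_sub_inf_le_abs _ _ _) ?_
      rw [inf_comm c, inf_comm c]
      exact abs_inf_sub_inf_le_abs _ _ _

/-- These are the positive and negative parts of `a - b`. This disjointness is what makes the lifts
in `exists_disjoint_lift` disjoint. -/
theorem inf_posPart_sub_eq_zero (a b : V) : ((a - b) ⊔ 0) ⊓ ((b - a) ⊔ 0) = 0 := by
  have := posPart_inf_negPart_eq_zero (a - b)
  rwa [posPart_def, negPart_def, neg_sub] at this

variable [Module ℝ V] [IsOrderedModule ℝ V]

/-- The vector sublattice generated by a linear subspace. -/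
def latticeSpan (W : Submodule ℝ V) : Submodule ℝ V where
  carrier := latticeClosure (W : Set V)
  zero_mem' := subset_latticeClosure W.zero_mem
  add_mem' := by
    -- Translations preserve suprema and infima, so membership of sums can be checked on generators,
    -- in one summand at a time.
    have step : ∀ s : Set V, ∀ c : V,
        (∀ w ∈ s, w + c ∈ latticeClosure (W : Set V)) →
        ∀ a ∈ latticeClosure s, a + c ∈ latticeClosure (W : Set V) := by
      intro s c h
      refine latticeClosure_min (t := {a | a + c ∈ latticeClosure (W : Set V)}) h ⟨?_, ?_⟩
      · intro a ha b hb
        simp only [Set.mem_ofPred_eq, sup_add] at *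
        exact isSublattice_latticeClosure.supClosed ha hb
      · intro a ha b hb
        simp only [Set.mem_ofPred_eq, inf_add] at *
        exact isSublattice_latticeClosure.infClosed ha hb
    intro a b ha hb
    refine step W b (fun w hw => ?_) a ha
    rw [add_comm]
    refine step W w (fun w' hw' => ?_) b hb
    exact subset_latticeClosure (W.add_mem hw' hw)
  smul_mem' := by
    -- Negation exchanges suprema and infima, so it is treated separately from positive scalars.
    have neg : ∀ a ∈ latticeClosure (W : Set V), -a ∈ latticeClosure (W : Set V) := by
      refine latticeClosure_min (t := {a | -a ∈ latticeClosure (W : Set V)})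
        (fun w hw => subset_latticeClosure (W.neg_mem hw)) ⟨?_, ?_⟩
      · intro a ha b hb
        simp only [Set.mem_ofPred_eq, neg_sup] at *
        exact isSublattice_latticeClosure.infClosed ha hb
      · intro a ha b hb
        simp only [Set.mem_ofPred_eq, neg_inf] at *
        exact isSublattice_latticeClosure.supClosed ha hb
    have pos : ∀ c : ℝ, 0 < c → ∀ a ∈ latticeClosure (W : Set V),
        c • a ∈ latticeClosure (W : Set V) := by
      intro c hc
      refine latticeClosure_min (t := {a | c • a ∈ latticeClosure (W : Set V)})
        (fun w hw => subset_latticeClosure (W.smul_mem c hw)) ⟨?_, ?_⟩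
      · intro a ha b hb
        simp only [Set.mem_ofPred_eq, smul_sup_of_pos hc] at *
        exact isSublattice_latticeClosure.supClosed ha hb
      · intro a ha b hb
        simp only [Set.mem_ofPred_eq, smul_inf_of_pos hc] at *
        exact isSublattice_latticeClosure.infClosed ha hb
    intro c a ha
    rcases lt_trichotomy c 0 with hc | rfl | hc
    · rw [← neg_smul_neg]
      exact pos _ (neg_pos.2 hc) _ (neg a ha)
    · rw [zero_smul]
      exact subset_latticeClosure W.zero_mem
    · exact pos c hc a ha

theorem isSublattice_latticeSpan (W : Submodule ℝ V) : IsSublattice (latticeSpan W : Set V) :=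
  isSublattice_latticeClosure

theorem le_latticeSpan (W : Submodule ℝ V) : W ≤ latticeSpan W := fun _ h =>
  subset_latticeClosure h

/-- An element of the vector sublattice generated by `W` is a finite supremum of finite infima of
elements of `W`. -/
theorem mem_latticeSpan_iff {W : Submodule ℝ V} {a : V} :
    a ∈ latticeSpan W ↔ a ∈ supClosure (infClosure (W : Set V)) := by
  -- Vector lattices are distributive, which is what allows the normal form as a supremum of infima.
  let : DistribLattice V := AddCommGroup.toDistribLattice V
  change a ∈ latticeClosure (W : Set V) ↔ _
  rw [supClosure_infClosure]

/-- The relatively uniform closure of a vector sublattice. -/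
def relUniformClosure (L : Submodule ℝ V) : Submodule ℝ V where
  carrier := {v | ∃ p ∈ L, ∀ ε : ℝ, 0 < ε → ∃ q ∈ L, |v - q| ≤ ε • p}
  zero_mem' := ⟨0, L.zero_mem, fun ε _ => ⟨0, L.zero_mem, by simp⟩⟩
  add_mem' := by
    rintro v w ⟨p, hp, h⟩ ⟨p', hp', h'⟩
    refine ⟨p + p', L.add_mem hp hp', fun ε hε => ?_⟩
    obtain ⟨q, hq, e⟩ := h ε hε
    obtain ⟨q', hq', e'⟩ := h' ε hε
    refine ⟨q + q', L.add_mem hq hq', ?_⟩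
    rw [add_sub_add_comm, smul_add]
    exact (abs_add_le _ _).trans (add_le_add e e')
  smul_mem' := by
    rintro c v ⟨p, hp, h⟩
    refine ⟨|c| • p, L.smul_mem _ hp, fun ε hε => ?_⟩
    obtain ⟨q, hq, e⟩ := h ε hε
    refine ⟨c • q, L.smul_mem c hq, ?_⟩
    rw [← smul_sub, smul_comm]
    exact (abs_smul_le_smul_abs _ _).trans (smul_le_smul_of_nonneg_left e (abs_nonneg c))

/-- The lattice operations are nonexpansive with respect to `|·|`, so the regulators of the two
elements simply add up. -/
theorem isSublattice_relUniformClosure {L : Submodule ℝ V} (hL : IsSublattice (L : Set V)) :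
    IsSublattice (relUniformClosure L : Set V) := by
  constructor
  · rintro v ⟨p, hp, h⟩ w ⟨p', hp', h'⟩
    refine ⟨p + p', L.add_mem hp hp', fun ε hε => ?_⟩
    obtain ⟨q, hq, e⟩ := h ε hε
    obtain ⟨q', hq', e'⟩ := h' ε hε
    refine ⟨q ⊔ q', hL.supClosed hq hq', ?_⟩
    rw [smul_add]
    exact (abs_sup_sub_sup_le_add _ _ _ _).trans (add_le_add e e')
  · rintro v ⟨p, hp, h⟩ w ⟨p', hp', h'⟩
    refine ⟨p + p', L.add_mem hp hp', fun ε hε => ?_⟩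
    obtain ⟨q, hq, e⟩ := h ε hε
    obtain ⟨q', hq', e'⟩ := h' ε hε
    refine ⟨q ⊓ q', hL.infClosed hq hq', ?_⟩
    rw [smul_add]
    exact (abs_inf_sub_inf_le_add _ _ _ _).trans (add_le_add e e')

theorem le_relUniformClosure (L : Submodule ℝ V) : L ≤ relUniformClosure L := fun v hv =>
  ⟨0, L.zero_mem, fun ε _ => ⟨v, hv, by simp⟩⟩

end VectorLattice

theorem PreservesLattice.map_abs {X Y : Type*} [AddCommGroup X] [Module ℝ X] [Lattice X]
    [AddCommGroup Y] [Module ℝ Y] [Lattice Y] {T : X →ₗ[ℝ] Y} (hT : PreservesLattice T) (x : X) :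
    T |x| = |T x| := by
  rw [abs, abs, (hT x (-x)).1, map_neg]

theorem PreservesLattice.monotone {X Y : Type*} [Lattice X] [Lattice Y] {T : X → Y}
    (hT : PreservesLattice T) : Monotone T := fun x y h => by
  rw [← sup_eq_right, ← (hT x y).1, sup_eq_right.2 h]

/-! ### Density of lattice-linear functions among positively homogeneous functions -/

namespace PosHom

variable {m : ℕ}

/-- The unit sphere of the `ℓ₁`-norm. -/
abbrev L1Sphere (m : ℕ) : Type := {t : Fin m → ℝ // ∑ k, |t k| = 1}

instance : CompactSpace (L1Sphere m) := by
  refine isCompact_iff_compactSpace.1 (Metric.isCompact_of_isClosed_isBounded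
    (s := {t : Fin m → ℝ | ∑ k, |t k| = 1}) (isClosed_eq (by fun_prop) continuous_const) ?_)
  refine (Metric.isBounded_closedBall (x := (0 : Fin m → ℝ)) (r := 1)).subset fun t ht => ?_
  rw [mem_closedBall_zero_iff, pi_norm_le_iff_of_nonneg zero_le_one]
  intro k
  rw [Real.norm_eq_abs, ← (show ∑ k, |t k| = 1 from ht)]
  exact Finset.single_le_sum (f := fun k => |t k|) (fun _ _ => abs_nonneg _) (Finset.mem_univ k)

/-- Restriction of a positively homogeneous function to the `ℓ₁`-sphere. -/
def restrict (h : PosHom m) : C(L1Sphere m, ℝ) := ⟨fun t => h.1 t.1, h.2.1.comp (by fun_prop)⟩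

theorem coe_sum {ι : Type*} (s : Finset ι) (f : ι → PosHom m) (t : Fin m → ℝ) :
    (∑ i ∈ s, f i).1 t = ∑ i ∈ s, (f i).1 t := by
  simp

/-- The function `∑ |π_k|`. -/
def l1 (m : ℕ) : PosHom m := ∑ k, (proj k ⊔ -proj k)

theorem l1_apply (t : Fin m → ℝ) : (l1 m).1 t = ∑ k, |t k| := coe_sum _ _ _

/-- Every element of `ℋ_m` can be approximated, relative to `∑ |π_k|`, by the elements of a vector
sublattice which contains the coordinate projections. -/
theorem exists_approx {A : Submodule ℝ (PosHom m)} (hA : IsSublattice (A : Set (PosHom m)))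
    (hproj : ∀ k, proj k ∈ A) (h : PosHom m) {ε : ℝ} (hε : 0 < ε) :
    ∃ g ∈ A, ∀ t, |h.1 t - g.1 t| ≤ ε * ∑ k, |t k| := by
  -- On the `ℓ₁`-sphere `l1` is the constant `1`, so it replaces the constants that homogeneous
  -- functions lack.
  have hl1 : l1 m ∈ A :=
    A.sum_mem fun k _ => hA.supClosed (hproj k) (A.neg_mem (hproj k))
  have hcl : closure (restrict '' (A : Set (PosHom m))) = ⊤ := by
    -- Lattice form of Stone–Weierstrass: it suffices to interpolate arbitrary values at any two
    -- points of the sphere.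
    refine ContinuousMap.sublattice_closure_eq_top _ ⟨_, 0, A.zero_mem, rfl⟩ ?_ ?_ ?_
    · rintro _ ⟨f, hf, rfl⟩ _ ⟨g, hg, rfl⟩
      exact ⟨f ⊓ g, hA.infClosed hf hg, rfl⟩
    · rintro _ ⟨f, hf, rfl⟩ _ ⟨g, hg, rfl⟩
      exact ⟨f ⊔ g, hA.supClosed hf hg, rfl⟩
    · intro v x y
      by_cases hxy : x = y
      · subst hxy
        refine ⟨_, ⟨v x • l1 m, A.smul_mem _ hl1, rfl⟩, ?_⟩
        have : v x * (l1 m).1 x.1 = v x := by rw [l1_apply, x.2, mul_one]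
        exact ⟨this, this⟩
      · obtain ⟨k, hk⟩ : ∃ k, x.1 k ≠ y.1 k := by
          by_contra! hc
          exact hxy (Subtype.ext (funext hc))
        have hk' : x.1 k - y.1 k ≠ 0 := sub_ne_zero.2 hk
        -- Slope of the affine function of the `k`-th coordinate which takes the values `v x` and `v
        -- y`; its constant term is a multiple of `l1`.
        set c := (v x - v y) / (x.1 k - y.1 k) with hc
        refine ⟨_, ⟨c • proj k + (v x - c * x.1 k) • l1 m,
          A.add_mem (A.smul_mem _ (hproj k)) (A.smul_mem _ hl1), rfl⟩, ?_, ?_⟩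
        · change c * x.1 k + (v x - c * x.1 k) * (l1 m).1 x.1 = v x
          rw [l1_apply, x.2]
          ring
        · change c * y.1 k + (v x - c * x.1 k) * (l1 m).1 y.1 = v y
          rw [l1_apply, y.2, hc]
          field_simp
          ring
  have hmem : restrict h ∈ closure (restrict '' (A : Set (PosHom m))) := hcl ▸ Set.mem_univ _
  obtain ⟨_, ⟨g, hg, rfl⟩, hd⟩ := Metric.mem_closure_iff.1 hmem ε hε
  refine ⟨g, hg, fun t => ?_⟩
  have hs0 : 0 ≤ ∑ k, |t k| := Finset.sum_nonneg fun _ _ => abs_nonneg _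
  rcases hs0.eq_or_lt with hs | hs
  · have ht : t = 0 := by
      funext k
      have := (Finset.sum_eq_zero_iff_of_nonneg fun k _ => abs_nonneg (t k)).1 hs.symm k
        (Finset.mem_univ k)
      exact abs_eq_zero.1 this
    have e : ∀ f : PosHom m, f.1 0 = 0 := fun f => by
      simpa using f.2.2 0 0 le_rfl
    rw [ht, e, e]
    simp
  -- Homogeneity transfers the uniform bound on the sphere to the ray through `t`.
  · set s := ∑ k, |t k|
    have hw : ∑ k, |(s⁻¹ • t) k| = 1 := by
      simp only [Pi.smul_apply, smul_eq_mul, abs_mul, ← Finset.mul_sum]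
      rw [abs_of_pos (inv_pos.2 hs), inv_mul_cancel₀ hs.ne']
    have e : ∀ f : PosHom m, f.1 t = s * f.1 (s⁻¹ • t) := fun f => by
      rw [← f.2.2 _ _ hs.le, smul_smul, mul_inv_cancel₀ hs.ne', one_smul]
    have hb := (ContinuousMap.dist_apply_le_dist
      (f := restrict h) (g := restrict g) ⟨s⁻¹ • t, hw⟩).trans hd.le
    rw [e h, e g, ← mul_sub, abs_mul, abs_of_pos hs, mul_comm ε]
    exact mul_le_mul_of_nonneg_left hb hs.le

end PosHom

/-! ### Extension of linear maps on `E` to lattice homomorphisms on `Y₀`. -/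

instance {V V' : Type*} [AddCommGroup V] [Module ℝ V] [PartialOrder V] [IsOrderedModule ℝ V]
    [AddCommGroup V'] [Module ℝ V'] [PartialOrder V'] [IsOrderedModule ℝ V'] :
    IsOrderedModule ℝ (V × V') where
  smul_le_smul_of_nonneg_left _ hr _ _ h :=
    ⟨smul_le_smul_of_nonneg_left h.1 hr, smul_le_smul_of_nonneg_left h.2 hr⟩
  smul_le_smul_of_nonneg_right _ hp _ _ h :=
    ⟨smul_le_smul_of_nonneg_right h hp.1, smul_le_smul_of_nonneg_right h hp.2⟩

namespace PreFBL

variable {E : Type u} [NormedAddCommGroup E] [NormedSpace ℝ E] {D : ConvexityCondition}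

/-- The map `h ↦ h(δ_{x_1}, …, δ_{x_m})`. -/
def ofPosHom {m : ℕ} (x : Fin m → E) : PosHom m →ₗ[ℝ] PreFBL E D where
  toFun h := ⟨evalComp h x, m, h, x, rfl⟩
  map_add' _ _ := rfl
  map_smul' _ _ := rfl

theorem exists_ofPosHom_eq (f : PreFBL E D) :
    ∃ (m : ℕ) (h : PosHom m) (x : Fin m → E), ofPosHom x h = f := by
  obtain ⟨m, h, x, e⟩ := f.2
  exact ⟨m, h, x, Subtype.ext e.symm⟩

/-- The linear map `x ↦ δ_x`. -/
def deltaₗ : E →ₗ[ℝ] PreFBL E D where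
  toFun := delta
  map_add' x y := toFun_injective (funext fun φ => map_add φ.1 x y)
  map_smul' c x := toFun_injective (funext fun φ => map_smul φ.1 c x)

/-- A vector sublattice of `Y₀` which contains all `δ_x` is relatively uniformly dense. -/
theorem exists_approx {A : Submodule ℝ (PreFBL E D)} (hA : IsSublattice (A : Set (PreFBL E D)))
    (hdelta : ∀ x, delta x ∈ A) (f : PreFBL E D) :
    ∃ u ∈ A, ∀ ε : ℝ, 0 < ε → ∃ g ∈ A, |f - g| ≤ ε • u := by
  obtain ⟨m, h, x, rfl⟩ := exists_ofPosHom_eq f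
  let B : Submodule ℝ (PosHom m) := A.comap (ofPosHom x)
  have hB : IsSublattice (B : Set (PosHom m)) :=
    ⟨fun a ha b hb => hA.supClosed ha hb, fun a ha b hb => hA.infClosed ha hb⟩
  have hproj : ∀ k, PosHom.proj k ∈ B := fun k => hdelta (x k)
  have hl1 : PosHom.l1 m ∈ B :=
    B.sum_mem fun k _ => hB.supClosed (hproj k) (B.neg_mem (hproj k))
  refine ⟨ofPosHom x (PosHom.l1 m), hl1, fun ε hε => ?_⟩
  obtain ⟨g, hg, hgb⟩ := PosHom.exists_approx hB hproj h hε
  refine ⟨ofPosHom x g, hg, fun φ => ?_⟩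
  change |h.1 _ - g.1 _| ≤ ε * (PosHom.l1 m).1 _
  rw [PosHom.l1_apply]
  exact hgb _

/-- If the infimum of finitely many point evaluations is negative, then so is the infimum of the
images of these points under any linear map into a vector lattice. -/
theorem inf'_nonpos_of_inf'_delta_nonpos {X : Type v} [AddCommGroup X] [Module ℝ X] [Lattice X]
    [IsOrderedAddMonoid X] [IsOrderedModule ℝ X] (S : E →ₗ[ℝ] X) (s : Finset E) (hs : s.Nonempty)
    (h : ∀ φ : DualBall E, ∃ x ∈ s, φ.1 x ≤ 0) : s.inf' hs S ≤ 0 := by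
  -- Otherwise a functional is strictly positive on the hull; scaled into the dual ball, it
  -- contradicts `h`.
  have h0 : (0 : E) ∈ convexHull ℝ (s : Set E) := by
    by_contra hn
    obtain ⟨φ, r, hr, hb⟩ := geometric_hahn_banach_point_closed (convex_convexHull ℝ (s : Set E))
      (s.finite_toSet.isCompact_convexHull ℝ).isClosed hn
    rw [map_zero] at hr
    have hφ : ‖φ‖ ≤ ‖φ‖ + 1 := by linarith
    have hpos : 0 < ‖φ‖ + 1 := by positivity
    obtain ⟨x, hx, hx'⟩ := h ⟨(‖φ‖ + 1)⁻¹ • φ, by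
      rw [mem_closedBall_zero_iff, norm_smul, norm_inv, Real.norm_of_nonneg hpos.le]
      exact inv_mul_le_one_of_le₀ hφ hpos.le⟩
    have h1 : (‖φ‖ + 1)⁻¹ * φ x ≤ 0 := hx'
    have h2 : 0 < (‖φ‖ + 1)⁻¹ * φ x :=
      mul_pos (inv_pos.2 hpos) (hr.trans (hb x (subset_convexHull ℝ _ hx)))
    exact h1.not_gt h2
  -- This convex set contains `s`, hence also `0`, which says that the infimum is at most `S 0 = 0`.
  have hconv : Convex ℝ {x : E | s.inf' hs S ≤ S x} :=
    (convex_Ici (s.inf' hs S)).linear_preimage S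
  have := convexHull_min (fun x hx => Finset.inf'_le S hx) hconv h0
  simpa using this

section Extension

variable {X : Type v} [AddCommGroup X] [Module ℝ X] [Lattice X]
    [IsOrderedAddMonoid X] [IsOrderedModule ℝ X] (S : E →ₗ[ℝ] X)

/-- The vector sublattice of `Y₀ × X` generated by the pairs `(δ_x, S x)`. -/
def graphSpan (D : ConvexityCondition) : Submodule ℝ (PreFBL E D × X) :=
  latticeSpan (LinearMap.range ((deltaₗ : E →ₗ[ℝ] PreFBL E D).prod S))

/-- Writing `p` as a supremum of infima of pairs `(δ_x, S x)`, each infimum again has nonpositive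
first coordinate, and the Hahn–Banach lemma above applies to it. This makes the passage from first
to second coordinates order preserving. -/
theorem snd_nonpos_of_mem_graphSpan {p : PreFBL E D × X} (hp : p ∈ graphSpan S D)
    (h : p.1 ≤ 0) : p.2 ≤ 0 := by
  rw [graphSpan, mem_latticeSpan_iff] at hp
  obtain ⟨t, ht, hts, rfl⟩ := hp
  have key : ∀ q ∈ t, q.2 ≤ 0 := by
    intro q hq
    have hq1 : q.1 ≤ 0 := (Prod.mk_le_mk.1 (Finset.le_sup' id hq)).1.trans h
    obtain ⟨r, hr, hrs, rfl⟩ := hts hq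
    classical
    choose x hx using fun w : r => hrs w.2
    let s : Finset E := Finset.univ.image x
    have hs : s.Nonempty := by
      obtain ⟨w, hw⟩ := hr
      exact ⟨x ⟨w, hw⟩, Finset.mem_image_of_mem _ (Finset.mem_univ _)⟩
    have hle : s.inf' hs S ≤ 0 := by
      refine inf'_nonpos_of_inf'_delta_nonpos S s hs fun φ => ?_
      -- If all the points evaluate positively at `φ`, so does the minimum of their `δ_x`, against
      -- `hq1`.
      by_contra! hc
      have hpos : r.inf' hr id ∈ {q : PreFBL E D × X | 0 < q.1.toFun φ} := by
        refine InfClosed.finsetInf'_mem (fun a ha b hb => ?_) hr fun w hw => ?_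
        · exact lt_min (show 0 < a.1.toFun φ from ha) (show 0 < b.1.toFun φ from hb)
        have h1 := hc _ (Finset.mem_image_of_mem x (Finset.mem_univ ⟨w, hw⟩))
        have h2 := congrArg (fun q : PreFBL E D × X => q.1.toFun φ) (hx ⟨w, hw⟩)
        exact h1.trans_eq h2
      exact (hq1 φ).not_gt hpos
    refine le_trans ?_ hle
    refine Finset.le_inf' _ _ fun y hy => ?_
    obtain ⟨w, -, rfl⟩ := Finset.mem_image.1 hy
    have : r.inf' hr id ≤ w.1 := Finset.inf'_le id w.2
    rw [← hx w] at this
    exact this.2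
  have : t.sup' ht id ≤ ((t.sup' ht id).1, (0 : X)) := by
    refine Finset.sup'_le _ _ fun q hq => ⟨(Finset.le_sup' id hq).1, key q hq⟩
  exact this.2

theorem snd_nonneg_of_mem_graphSpan {p : PreFBL E D × X} (hp : p ∈ graphSpan S D)
    (h : 0 ≤ p.1) : 0 ≤ p.2 := by
  have := snd_nonpos_of_mem_graphSpan S ((graphSpan S D).neg_mem hp) (neg_nonpos.2 h)
  exact neg_nonpos.1 this

theorem abs_snd_le_of_mem_graphSpan {p q : PreFBL E D × X} (hp : p ∈ graphSpan S D)
    (hq : q ∈ graphSpan S D) (h : |p.1| ≤ q.1) : |p.2| ≤ q.2 := by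
  obtain ⟨h1, h2⟩ := abs_le'.1 h
  refine abs_le'.2 ⟨sub_nonneg.1 ?_, sub_nonneg.1 ?_⟩
  · exact snd_nonneg_of_mem_graphSpan S ((graphSpan S D).sub_mem hq hp) (sub_nonneg.2 h1)
  · exact snd_nonneg_of_mem_graphSpan S ((graphSpan S D).sub_mem hq ((graphSpan S D).neg_mem hp))
      (sub_nonneg.2 h2)

end Extension

end PreFBL

/-- A vector sublattice of a product which is the graph of a function is the graph of a lattice
homomorphism. -/
theorem exists_latticeHom_of_graph {Y : Type u} {X : Type v} [AddCommGroup Y] [Module ℝ Y]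
    [Lattice Y] [AddCommGroup X] [Module ℝ X] [Lattice X] {R : Submodule ℝ (Y × X)}
    (hsub : IsSublattice (R : Set (Y × X))) (htotal : ∀ f, ∃ y, (f, y) ∈ R)
    (hzero : ∀ y, ((0, y) : Y × X) ∈ R → y = 0) :
    ∃ T : Y →ₗ[ℝ] X, PreservesLattice T ∧ ∀ {f y}, (f, y) ∈ R → T f = y := by
  have huniq : ∀ {f : Y} {y z : X}, (f, y) ∈ R → (f, z) ∈ R → y = z := fun hy hz =>
    sub_eq_zero.1 (hzero _ (by simpa using R.sub_mem hy hz))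
  choose T hT using htotal
  exact ⟨{ toFun := T
           map_add' := fun f g => huniq (hT _) (R.add_mem (hT f) (hT g))
           map_smul' := fun c f => huniq (hT _) (R.smul_mem c (hT f)) },
    fun f g => ⟨huniq (hT _) (hsub.supClosed (hT f) (hT g)),
      huniq (hT _) (hsub.infClosed (hT f) (hT g))⟩, fun h => huniq (hT _) h⟩

namespace PreFBL

variable {E : Type u} [NormedAddCommGroup E] [NormedSpace ℝ E] {D : ConvexityCondition}

section Banach

variable {X : Type v} [NormedAddCommGroup X] [NormedSpace ℝ X] [Lattice X] [IsBanachLattice X]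
  (S : E →ₗ[ℝ] X)

/-- Positivity survives the closure: an `ε`-approximant `q` becomes positive in the first coordinate
after adding `ε • r`, so `p.2 ≥ -2ε • r.2`; then `ε → 0`, the positive cone of `X` being closed. -/
theorem snd_nonneg_of_mem_relUniformClosure {p : PreFBL E D × X}
    (hp : p ∈ relUniformClosure (graphSpan S D)) (h : 0 ≤ p.1) : 0 ≤ p.2 := by
  obtain ⟨r, hr, happ⟩ := hp
  have key : ∀ ε : ℝ, 0 < ε → -p.2 ≤ (2 * ε) • r.2 := by
    intro ε hε
    obtain ⟨q, hq, hle⟩ := happ ε hε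
    have h1 : p.1 - q.1 ≤ ε • r.1 := (le_abs_self _).trans hle.1
    have h2 : -(p.2 - q.2) ≤ ε • r.2 := (neg_le_abs _).trans hle.2
    have h3 : 0 ≤ ε • r.2 + q.2 := by
      refine snd_nonneg_of_mem_graphSpan S
        ((graphSpan S D).add_mem ((graphSpan S D).smul_mem ε hr) hq) ?_
      have : p.1 ≤ ε • r.1 + q.1 := sub_le_iff_le_add.1 h1
      exact h.trans this
    have h4 : -q.2 ≤ ε • r.2 := neg_le_iff_add_nonneg.2 h3
    calc -p.2 = -(p.2 - q.2) + -q.2 := by abel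
      _ ≤ ε • r.2 + ε • r.2 := add_le_add h2 h4
      _ = (2 * ε) • r.2 := by rw [← add_smul, two_mul]
  have hlim : Filter.Tendsto (fun ε : ℝ => (2 * ε) • r.2) (nhdsWithin 0 (Set.Ioi 0)) (nhds 0) := by
    have : Continuous fun ε : ℝ => (2 * ε) • r.2 := by fun_prop
    simpa using (this.tendsto 0).mono_left nhdsWithin_le_nhds
  exact neg_nonpos.1 (ge_of_tendsto hlim (Filter.eventually_of_mem self_mem_nhdsWithin key))

/-- First coordinates of `graphSpan` approximate `f` with a regulator `p.1`. The same estimates hold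
for the second coordinates with regulator `p.2`, so these form a norm Cauchy sequence whose limit is
the required `y`. -/
theorem exists_mem_relUniformClosure (f : PreFBL E D) :
    ∃ y : X, (f, y) ∈ relUniformClosure (graphSpan S D) := by
  let A : Submodule ℝ (PreFBL E D) := (graphSpan S D).map (LinearMap.fst ℝ (PreFBL E D) X)
  have hL : IsSublattice (graphSpan S D : Set (PreFBL E D × X)) := isSublattice_latticeSpan _
  have hA : IsSublattice (A : Set (PreFBL E D)) := by
    constructor
    · rintro _ ⟨a, ha, rfl⟩ _ ⟨b, hb, rfl⟩
      exact ⟨a ⊔ b, hL.supClosed ha hb, rfl⟩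
    · rintro _ ⟨a, ha, rfl⟩ _ ⟨b, hb, rfl⟩
      exact ⟨a ⊓ b, hL.infClosed ha hb, rfl⟩
  obtain ⟨_, ⟨p, hp, rfl⟩, happ⟩ := exists_approx hA
    (fun x => ⟨(deltaₗ x, S x), le_latticeSpan _ ⟨x, rfl⟩, rfl⟩) f
  have happ' : ∀ n : ℕ, ∃ q ∈ graphSpan S D, |f - q.1| ≤ ((1 / 2 : ℝ) ^ n) • p.1 := by
    intro n
    obtain ⟨_, ⟨q, hq, rfl⟩, hle⟩ := happ ((1 / 2) ^ n) (by positivity)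
    exact ⟨q, hq, hle⟩
  choose q hq hle using happ'
  have hdist : ∀ n k, |(q n).2 - (q k).2| ≤ ((1 / 2 : ℝ) ^ n + (1 / 2) ^ k) • p.2 := by
    intro n k
    refine abs_snd_le_of_mem_graphSpan S (p := q n - q k)
      (q := ((1 / 2 : ℝ) ^ n + (1 / 2) ^ k) • p) ((graphSpan S D).sub_mem (hq n) (hq k))
      ((graphSpan S D).smul_mem _ hp) ?_
    calc |(q n).1 - (q k).1| = |-(f - (q n).1) + (f - (q k).1)| := by congr 1; abel
      _ ≤ |-(f - (q n).1)| + |f - (q k).1| := abs_add_le _ _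
      _ ≤ (1 / 2 : ℝ) ^ n • p.1 + (1 / 2 : ℝ) ^ k • p.1 := by
        rw [abs_neg]
        exact add_le_add (hle n) (hle k)
      _ = ((1 / 2 : ℝ) ^ n + (1 / 2) ^ k) • p.1 := (add_smul _ _ _).symm
  have hcauchy : CauchySeq fun n => (q n).2 := by
    refine cauchySeq_of_le_geometric (1 / 2) (2 * ‖p.2‖) (by norm_num) fun n => ?_
    rw [dist_eq_norm]
    have h1 := norm_le_norm_of_abs_le_abs ((hdist n (n + 1)).trans (le_abs_self _))
    rw [norm_smul, Real.norm_of_nonneg (by positivity)] at h1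
    refine h1.trans ?_
    have h2 : (1 / 2 : ℝ) ^ n + (1 / 2) ^ (n + 1) ≤ 2 * (1 / 2) ^ n := by
      rw [pow_succ]
      have : 0 < (1 / 2 : ℝ) ^ n := by positivity
      linarith
    calc ((1 / 2 : ℝ) ^ n + (1 / 2) ^ (n + 1)) * ‖p.2‖ ≤ (2 * (1 / 2) ^ n) * ‖p.2‖ :=
          mul_le_mul_of_nonneg_right h2 (norm_nonneg _)
      _ = 2 * ‖p.2‖ * (1 / 2) ^ n := by ring
  obtain ⟨y, hy⟩ := cauchySeq_tendsto_of_complete hcauchy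
  have hp1 : 0 ≤ p.1 := by
    have := (abs_nonneg _).trans (hle 0)
    simpa using this
  have hp2 : 0 ≤ p.2 := snd_nonneg_of_mem_graphSpan S hp hp1
  -- The pair `p` regulates both coordinates simultaneously; the bound on `y - (q n).2` is the limit
  -- `k → ∞` of `hdist k n`.
  refine ⟨y, p, hp, fun ε hε => ?_⟩
  obtain ⟨n, hn⟩ := exists_pow_lt_of_lt_one hε (by norm_num : (1 / 2 : ℝ) < 1)
  refine ⟨q n, hq n, (hle n).trans (smul_le_smul_of_nonneg_right hn.le hp1), ?_⟩
  have hlim : |y - (q n).2| ≤ (0 + (1 / 2 : ℝ) ^ n) • p.2 := by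
    have habs : Continuous fun z : X => |z| := continuous_id.sup continuous_neg
    refine le_of_tendsto_of_tendsto' ((habs.tendsto _).comp (hy.sub_const _)) ?_ fun k => hdist k n
    exact ((tendsto_pow_atTop_nhds_zero_of_lt_one (by norm_num) (by norm_num)).add_const
      _).smul_const _
  rw [zero_add] at hlim
  exact hlim.trans (smul_le_smul_of_nonneg_right hn.le hp2)

/-- Every linear map from `E` to a Banach lattice extends to a lattice homomorphism on `Y₀`. -/
theorem exists_latticeHom_extension :
    ∃ T : PreFBL E D →ₗ[ℝ] X, PreservesLattice T ∧ ∀ x, T (delta x) = S x := by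
  obtain ⟨T, hT, hmem⟩ := exists_latticeHom_of_graph (R := relUniformClosure (graphSpan S D))
    (isSublattice_relUniformClosure (isSublattice_latticeSpan _))
    -- Positivity applied to `(0, y)` and to its negative forces `y = 0`.
    (exists_mem_relUniformClosure S) fun y hy => by
      have hneg := snd_nonneg_of_mem_relUniformClosure S (Submodule.neg_mem _ hy) neg_zero.ge
      exact le_antisymm (neg_nonneg.1 hneg) (snd_nonneg_of_mem_relUniformClosure S hy le_rfl)
  exact ⟨T, hT, fun x => hmem (le_relUniformClosure _ (le_latticeSpan _ ⟨x, rfl⟩))⟩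

end Banach

end PreFBL

/-! ### The function calculus of a Banach lattice -/

section FunctionCalculus

variable {X : Type v} [NormedAddCommGroup X] [NormedSpace ℝ X] [Lattice X] [IsBanachLattice X]
  {m : ℕ}

/-- The tuple `x` is a linear map `ℝ^m → X`; extend it to `Y₀` over `ℝ^m` and precompose with `h ↦
h(δ_{e_1}, …, δ_{e_m})`. -/
theorem exists_isFunctionCalculus (D : ConvexityCondition) (x : Fin m → X) :
    ∃ Φ : PosHom m →ₗ[ℝ] X, IsFunctionCalculus x Φ := by
  obtain ⟨T, hT, hx⟩ := PreFBL.exists_latticeHom_extension (D := D) (Fintype.linearCombination ℝ x)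
  refine ⟨T ∘ₗ PreFBL.ofPosHom fun k => Pi.single k 1, fun f g => hT (PreFBL.ofPosHom _ f) (PreFBL.ofPosHom _ g),
    fun k => ?_⟩
  exact (hx (Pi.single k 1)).trans (by simp)

/-- The two maps agree on a vector sublattice containing the projections, which is dense relative to
`l1`; a lattice homomorphism turns `|f| ≤ ε • l1` into a norm bound. -/
theorem IsFunctionCalculus.ext {x : Fin m → X} {Φ Ψ : PosHom m →ₗ[ℝ] X}
    (hΦ : IsFunctionCalculus x Φ) (hΨ : IsFunctionCalculus x Ψ) : Φ = Ψ := by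
  let A : Submodule ℝ (PosHom m) := LinearMap.eqLocus Φ Ψ
  have hA : IsSublattice (A : Set (PosHom m)) := by
    constructor
    · intro f hf g hg
      change Φ (f ⊔ g) = Ψ (f ⊔ g)
      rw [(hΦ.1 f g).1, (hΨ.1 f g).1, show Φ f = Ψ f from hf, show Φ g = Ψ g from hg]
    · intro f hf g hg
      change Φ (f ⊓ g) = Ψ (f ⊓ g)
      rw [(hΦ.1 f g).2, (hΨ.1 f g).2, show Φ f = Ψ f from hf, show Φ g = Ψ g from hg]
  have hproj : ∀ k, PosHom.proj k ∈ A := fun k => (hΦ.2 k).trans (hΨ.2 k).symm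
  have bound : ∀ {Θ : PosHom m →ₗ[ℝ] X}, PreservesLattice Θ → ∀ (f : PosHom m) (ε : ℝ),
      (∀ t, |f.1 t| ≤ ε * ∑ k, |t k|) → ‖Θ f‖ ≤ |ε| * ‖Θ (PosHom.l1 m)‖ := by
    intro Θ hΘ f ε hf
    rw [← Real.norm_eq_abs, ← norm_smul, ← map_smul]
    refine norm_le_norm_of_abs_le_abs (le_trans ?_ (le_abs_self _))
    rw [← hΘ.map_abs]
    refine hΘ.monotone fun t => ?_
    change |f.1 t| ≤ ε * (PosHom.l1 m).1 t
    rw [PosHom.l1_apply]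
    exact hf t
  refine LinearMap.ext fun h => sub_eq_zero.1 (norm_eq_zero.1 ?_)
  set C := ‖Φ (PosHom.l1 m)‖ + ‖Ψ (PosHom.l1 m)‖
  have key : ∀ ε : ℝ, 0 < ε → ‖Φ h - Ψ h‖ ≤ ε * C := by
    intro ε hε
    obtain ⟨g, hg, hb⟩ := PosHom.exists_approx hA hproj h hε
    have h1 := bound hΦ.1 (h - g) ε hb
    have h2 := bound hΨ.1 (h - g) ε hb
    rw [abs_of_pos hε] at h1 h2
    have e : Φ h - Ψ h = Φ (h - g) - Ψ (h - g) := by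
      rw [map_sub, map_sub, show Φ g = Ψ g from hg]
      abel
    rw [e, mul_add]
    exact (norm_sub_le _ _).trans (add_le_add h1 h2)
  have hlim : Filter.Tendsto (fun ε : ℝ => ε * C) (nhdsWithin 0 (Set.Ioi 0)) (nhds 0) := by
    have : Continuous fun ε : ℝ => ε * C := by fun_prop
    simpa using (this.tendsto 0).mono_left nhdsWithin_le_nhds
  exact le_antisymm (ge_of_tendsto hlim (Filter.eventually_of_mem self_mem_nhdsWithin key))
    (norm_nonneg _)

end FunctionCalculus

/-! ### Universal property of the free `𝒟`-convex Banach lattice -/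

/-- The pullback of a `𝒟`-convex lattice seminorm along a lattice homomorphism is `𝒟`-convex. -/
theorem IsDConvexSeminorm.comp {D : ConvexityCondition} {Y : Type u} {X : Type v} [AddCommGroup Y]
    [Module ℝ Y] [Lattice Y] [AddCommGroup X] [Module ℝ X] [Lattice X] {ν : Seminorm ℝ X}
    (hν : IsDConvexSeminorm D ν) {T : Y →ₗ[ℝ] X} (hT : PreservesLattice T) :
    IsDConvexSeminorm D (ν.comp T) := by
  intro g x hx hdisj Φ hΦ
  refine hν g (fun k => T (x k)) (fun k => ?_) (fun hθ j k hjk => ?_) (T ∘ₗ Φ) ⟨fun f h => ?_, ?_⟩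
  · rw [← map_zero T]
    exact hT.monotone (hx k)
  · rw [← (hT _ _).2, hdisj hθ j k hjk, map_zero]
  · simp only [LinearMap.comp_apply, (hΦ.1 f h).1, (hΦ.1 f h).2]
    exact hT _ _
  · intro k
    rw [LinearMap.comp_apply, hΦ.2 k]

/-- `𝒟`-convexity of a seminorm is not affected by scaling. -/
theorem IsDConvexSeminorm.smul {D : ConvexityCondition} {X : Type v} [AddCommGroup X]
    [Module ℝ X] [Lattice X] {ν : Seminorm ℝ X} (hν : IsDConvexSeminorm D ν) (c : NNReal) :
    IsDConvexSeminorm D (c • ν) := by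
  intro g x hx hdisj Φ hΦ
  change (c : ℝ) * ν _ ≤ D.M g * g.1.2.1 ((c : ℝ) • fun k => ν (x k))
  rw [g.1.2.2.2 _ _ (NNReal.coe_nonneg c), mul_left_comm]
  exact mul_le_mul_of_nonneg_left (hν g x hx hdisj Φ hΦ) c.2

namespace FBL

variable {E : Type u} [NormedAddCommGroup E] [NormedSpace ℝ E] {D : ConvexityCondition}

theorem norm_embed_le (x : E) : ‖(embed x : FBL E D)‖ ≤ ‖x‖ := by
  refine (norm_incl (PreFBL.delta x)).trans_le ?_
  rw [PreFBL.norm_def, PreFBL.freeSeminorm_apply]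
  exact Real.iSup_le (fun ν => ν.2.2.2 x) (norm_nonneg x)

variable (E D) in
/-- The canonical embedding as a bounded operator. -/
def embedL : E →L[ℝ] FBL E D :=
  embed.mkContinuous 1 fun x => by rw [one_mul]; exact norm_embed_le x

variable (E D) in
theorem norm_embedL_le : ‖embedL E D‖ ≤ 1 := LinearMap.mkContinuous_norm_le _ zero_le_one _

/-- Lattice homomorphisms on `FBL^𝒟[E]` are determined by their values on `E`. -/
theorem latticeHom_ext {X : Type v} [NormedAddCommGroup X] [NormedSpace ℝ X] [Lattice X]
    {T U : FBL E D →L[ℝ] X} (hT : PreservesLattice T) (hU : PreservesLattice U)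
    (h : T.comp (embedL E D) = U.comp (embedL E D)) : T = U := by
  let A : Submodule ℝ (PreFBL E D) :=
    LinearMap.eqLocus (T.comp incl).toLinearMap (U.comp incl).toLinearMap
  have hmem : ∀ {f : PreFBL E D}, f ∈ A ↔ T (incl f) = U (incl f) := Iff.rfl
  have hA : IsSublattice (A : Set (PreFBL E D)) := by
    constructor
    · intro f hf g hg
      rw [SetLike.mem_coe, hmem] at *
      rw [incl_sup, (hT _ _).1, (hU _ _).1, hf, hg]
    · intro f hf g hg
      rw [SetLike.mem_coe, hmem] at *
      rw [incl_inf, (hT _ _).2, (hU _ _).2, hf, hg]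
  have hdelta : ∀ x, PreFBL.delta x ∈ A := fun x => DFunLike.congr_fun h x
  have hcl : IsClosed (A : Set (PreFBL E D)) :=
    isClosed_eq (T.comp incl).continuous (U.comp incl).continuous
  have hall : ∀ f, f ∈ A := by
    intro f
    -- Relatively uniform approximation implies norm approximation, and `A` is norm closed.
    obtain ⟨u, -, happ⟩ := PreFBL.exists_approx hA hdelta f
    refine hcl.closure_subset (Metric.mem_closure_iff.2 fun ε hε => ?_)
    have hpos : 0 < ‖u‖ + 1 := by positivity
    obtain ⟨g, hg, hle⟩ := happ (ε / (‖u‖ + 1)) (by positivity)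
    refine ⟨g, hg, ?_⟩
    rw [dist_eq_norm]
    refine (PreFBL.norm_le_of_abs_le (hle.trans (le_abs_self _))).trans_lt ?_
    rw [norm_smul, Real.norm_of_nonneg (by positivity), div_mul_eq_mul_div, div_lt_iff₀ hpos]
    exact mul_lt_mul_of_pos_left (lt_add_one _) hε
  exact ContinuousLinearMap.ext (induction₁ (isClosed_eq T.continuous U.continuous) hall)

variable {X : Type v} [NormedAddCommGroup X] [NormedSpace ℝ X] [Lattice X] [IsBanachLattice X]

/-- A lattice homomorphism from `Y₀` to a `𝒟`-convex Banach lattice is bounded by its norm on the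
point evaluations. -/
theorem norm_le_of_norm_delta_le (hX : IsDConvex D X) {T : PreFBL E D →ₗ[ℝ] X}
    (hT : PreservesLattice T) {C : ℝ} (hC : 0 ≤ C)
    (h : ∀ x : E, ‖T (PreFBL.delta x)‖ ≤ C * ‖x‖) (f : PreFBL E D) : ‖T f‖ ≤ C * ‖f‖ := by
  -- Passing to `c > C` permits division by `c` even when `C = 0`.
  have key : ∀ c : ℝ, C < c → ‖T f‖ ≤ c * ‖f‖ := by
    intro c hc
    have hc0 : 0 < c := hC.trans_lt hc
    let r : NNReal := ⟨c⁻¹, inv_nonneg.2 hc0.le⟩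
    let ν : Seminorm ℝ (PreFBL E D) := r • (normSeminorm ℝ X).comp T
    have hν : ν ∈ PreFBL.admissible E D := by
      refine ⟨fun a b hab => ?_, (IsDConvexSeminorm.comp hX hT).smul r, fun x => ?_⟩
      · refine mul_le_mul_of_nonneg_left ?_ r.2
        refine norm_le_norm_of_abs_le_abs ?_
        rw [← hT.map_abs, ← hT.map_abs]
        exact hT.monotone hab
      · change c⁻¹ * ‖T (PreFBL.delta x)‖ ≤ ‖x‖
        rw [inv_mul_le_iff₀ hc0]
        exact (h x).trans (mul_le_mul_of_nonneg_right hc.le (norm_nonneg x))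
    have hle : ν f ≤ ‖f‖ := by
      rw [PreFBL.norm_def, PreFBL.freeSeminorm_apply]
      obtain ⟨B, hB⟩ := Seminorm.bddAbove_iff.1 (PreFBL.bddAbove_admissible E D)
      exact le_ciSup (f := fun ν : PreFBL.admissible E D => ν.1 f)
        ⟨B f, by rintro _ ⟨μ, rfl⟩; exact hB ⟨μ.1, μ.2, rfl⟩ f⟩ ⟨ν, hν⟩
    exact (inv_mul_le_iff₀ hc0).1 hle
  refine ge_of_tendsto (x := nhdsWithin C (Set.Ioi C)) (f := fun c => c * ‖f‖) ?_
    (Filter.eventually_of_mem self_mem_nhdsWithin key)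
  have : Continuous fun c : ℝ => c * ‖f‖ := by fun_prop
  exact (this.tendsto C).mono_left nhdsWithin_le_nhds

/-- The universal property of `FBL^𝒟[E]`. -/
theorem exists_extension (hX : IsDConvex D X) (S : E →L[ℝ] X) :
    ∃ T : FBL E D →L[ℝ] X, PreservesLattice T ∧ T.comp (embedL E D) = S ∧ ‖T‖ ≤ ‖S‖ := by
  obtain ⟨T, hT, hS⟩ := PreFBL.exists_latticeHom_extension (D := D) S.toLinearMap
  have hb : ∀ f, ‖T f‖ ≤ ‖S‖ * ‖(incl f : FBL E D)‖ := fun f => by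
    rw [norm_incl]
    exact norm_le_of_norm_delta_le hX hT (norm_nonneg S)
      (fun x => by rw [hS]; exact S.le_opNorm x) f
  set T' : FBL E D →L[ℝ] X := T.extendOfNorm (incl : PreFBL E D →L[ℝ] FBL E D).toLinearMap with hT'
  have heq : ∀ f, T' (incl f) = T f := LinearMap.extendOfNorm_eq denseRange_incl ⟨_, hb⟩
  refine ⟨T', fun a b => ?_, ?_, ?_⟩
  · refine ⟨induction₂ (p := fun a b => T' (a ⊔ b) = T' a ⊔ T' b)
      (isClosed_eq (by fun_prop) (by fun_prop)) (fun a b => ?_) a b,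
      induction₂ (p := fun a b => T' (a ⊓ b) = T' a ⊓ T' b)
      (isClosed_eq (by fun_prop) (by fun_prop)) (fun a b => ?_) a b⟩
    · rw [← incl_sup, heq, heq, heq, (hT a b).1]
    · rw [← incl_inf, heq, heq, heq, (hT a b).2]
  · ext x
    exact (heq _).trans (hS x)
  · exact T'.opNorm_le_bound (norm_nonneg S)
      fun a => LinearMap.norm_extendOfNorm_apply_le denseRange_incl _ hb a

end FBL

/-! ### Quotients of `𝒟`-convex Banach lattices -/

namespace ClosedIdeal

variable {X : Type v} [NormedAddCommGroup X] [NormedSpace ℝ X] [Lattice X] [IsBanachLattice X]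
  (J : ClosedIdeal X)

theorem mkQ_preservesLattice : PreservesLattice J.mkQ := fun x y => ⟨J.mkQ_sup x y, J.mkQ_inf x y⟩

/-- Positive elements of a quotient have positive representatives of almost the same norm. -/
theorem exists_nonneg_norm_lt {p : J.Quot} (hp : 0 ≤ p) {ε : ℝ} (hε : 0 < ε) :
    ∃ x : X, 0 ≤ x ∧ J.mkQ x = p ∧ ‖x‖ < ‖p‖ + ε := by
  obtain ⟨x, rfl, hx⟩ := J.exists_norm_lt p hε
  exact ⟨|x|, abs_nonneg x, by rw [mkQ_abs, abs_of_nonneg hp], by rwa [norm_abs_eq_norm]⟩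

/-- Positive elements of a quotient have positive representatives of almost the same norm, which
are pairwise disjoint where the given elements are. -/
theorem exists_disjoint_lift {m : ℕ} {p : Fin m → J.Quot} (hp : ∀ k, 0 ≤ p k)
    (hdisj : ∀ j k, j ≠ k → p j ⊓ p k = 0) {ε : ℝ} (hε : 0 < ε) :
    ∃ x : Fin m → X, (∀ k, 0 ≤ x k) ∧ (∀ j k, j ≠ k → x j ⊓ x k = 0) ∧
      ∀ k, J.mkQ (x k) = p k ∧ ‖x k‖ ≤ ‖p k‖ + ε := by
  choose y hy hyp hyn using fun k => J.exists_nonneg_norm_lt (hp k) hε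
  -- The lift of `p k` is `y k` made disjoint from the others: the infimum over `j ≠ k` of `(y k - y
  -- j)⁺`, also cut off by `y k` to keep the norm small.
  let z : Fin m → Fin m → X := fun k j => if j = k then y k else (y k - y j) ⊔ 0
  have hz0 : ∀ k j, 0 ≤ z k j := fun k j => by
    dsimp only [z]
    split_ifs
    · exact hy k
    · exact le_sup_right
  have hzq : ∀ k j, J.mkQ (z k j) = p k := fun k j => by
    dsimp only [z]
    split_ifs with h
    · exact hyp k
    · rw [mkQ_sup, map_sub, map_zero, hyp, hyp]
      -- Disjointness of `p j` and `p k` gives `(p k - p j)⁺ = p k`, so the modification is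
      -- invisible in the quotient.
      have h1 := sub_inf (p k) (p j) (p k)
      rw [inf_comm, hdisj j k h, sub_zero, sub_self] at h1
      rw [sup_comm]
      exact h1.symm
  let x : Fin m → X := fun k => Finset.univ.inf' ⟨k, Finset.mem_univ k⟩ (z k)
  have hx0 : ∀ k, 0 ≤ x k := fun k => Finset.le_inf' _ _ fun j _ => hz0 k j
  have hxz : ∀ k j, x k ≤ z k j := fun k j => Finset.inf'_le _ (Finset.mem_univ j)
  refine ⟨x, hx0, fun j k hjk => le_antisymm ?_ (le_inf (hx0 j) (hx0 k)), fun k => ⟨?_, ?_⟩⟩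
  · refine (inf_le_inf (hxz j k) (hxz k j)).trans ?_
    dsimp only [z]
    rw [if_neg hjk.symm, if_neg hjk, inf_posPart_sub_eq_zero]
  · have := Finset.apply_inf'_eq_inf'_comp (s := Finset.univ) ⟨k, Finset.mem_univ k⟩ (f := z k)
      J.mkQ fun a b => J.mkQ_inf a b
    refine this.trans ?_
    rw [show J.mkQ ∘ z k = fun _ => p k from funext (hzq k)]
    exact Finset.inf'_const _ _
  · refine (norm_le_norm_of_abs_le_abs ?_).trans (hyn k).le
    rw [abs_of_nonneg (hx0 k), abs_of_nonneg (hy k)]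
    exact (hxz k k).trans_eq (if_pos rfl)

/-- Quotients of `𝒟`-convex Banach lattices by closed ideals are `𝒟`-convex. -/
theorem isDConvex_quot {D : ConvexityCondition} (hX : IsDConvex D X) : IsDConvex D J.Quot := by
  intro g p hp hdisj Φ hΦ
  have key : ∀ ε : ℝ, 0 < ε → ‖Φ g.1.2‖ ≤ D.M g * g.1.2.1 fun k => ‖p k‖ + ε := by
    intro ε hε
    obtain ⟨x, hx0, hxd, hx⟩ : ∃ x : Fin g.1.1 → X, (∀ k, 0 ≤ x k) ∧
        (D.theta g = 0 → ∀ j k, j ≠ k → x j ⊓ x k = 0) ∧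
        ∀ k, J.mkQ (x k) = p k ∧ ‖x k‖ ≤ ‖p k‖ + ε := by
      by_cases hθ : D.theta g = 0
      · obtain ⟨x, h0, hd, h⟩ := J.exists_disjoint_lift hp (hdisj hθ) hε
        exact ⟨x, h0, fun _ => hd, h⟩
      · choose x h0 h1 h2 using fun k => J.exists_nonneg_norm_lt (hp k) hε
        exact ⟨x, h0, fun h => absurd h hθ, fun k => ⟨h1 k, (h2 k).le⟩⟩
    obtain ⟨Ψ, hΨ⟩ := exists_isFunctionCalculus D x
    -- The image of the calculus at `x` is a calculus at `p`, hence equals `Φ` by uniqueness. So `Φ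
    -- g` is the image of `g(x)`, which `hX` bounds.
    have hQ : IsFunctionCalculus p (J.mkQ.toLinearMap ∘ₗ Ψ) := by
      refine ⟨fun f h => ?_, fun k => ?_⟩
      · simp only [LinearMap.comp_apply, (hΨ.1 f h).1, (hΨ.1 f h).2]
        exact J.mkQ_preservesLattice _ _
      · rw [LinearMap.comp_apply, hΨ.2 k]
        exact (hx k).1
    rw [hΦ.ext hQ]
    refine (J.norm_mkQ_le _).trans ((hX g x hx0 hxd Ψ hΨ).trans ?_)
    exact mul_le_mul_of_nonneg_left
      (D.monotone g.1 g.2 _ _ (fun k => norm_nonneg _) fun k => (hx k).2)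
      (zero_le_one.trans (D.one_le_M g))
  -- Monotonicity of `g` has absorbed the errors in the norms of the lifts; its continuity now
  -- removes `ε`.
  refine ge_of_tendsto (x := nhdsWithin (0 : ℝ) (Set.Ioi 0))
    (f := fun ε => D.M g * g.1.2.1 fun k => ‖p k‖ + ε) ?_
    (Filter.eventually_of_mem self_mem_nhdsWithin key)
  have hcont : Continuous fun ε : ℝ => D.M g * g.1.2.1 fun k => ‖p k‖ + ε :=
    continuous_const.mul (g.1.2.2.1.comp (by fun_prop))
  have := (hcont.tendsto 0).mono_left (nhdsWithin_le_nhds (s := Set.Ioi 0))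
  simpa using this

end ClosedIdeal

end

/-- Let `𝒟' ≤ 𝒟` be convexity conditions and `E` a Banach space. Then linear projectivity of `E`,
projectivity of `FBL^{𝒟'}[E]`, and the existence of almost norm-preserving linear lifts of lattice
homomorphisms on `FBL^{𝒟'}[E]`, each for `𝒟`-convex Banach lattices, are equivalent. -/
theorem proposition4p6 (D D' : ConvexityCondition) (hD : ConvexityCondition.Weaker.{v} D' D)
    (E : Type u) [NormedAddCommGroup E] [NormedSpace ℝ E] [CompleteSpace E] :
    List.TFAE
      [IsLinearlyProjectiveFor.{u, v} D E,
       IsProjectiveFor.{u, v} D (FBL E D'),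
       ∀ (X : Type v) [NormedAddCommGroup X] [NormedSpace ℝ X] [Lattice X] [IsBanachLattice X],
         IsDConvex D X → ∀ (J : ClosedIdeal X) (T : FBL E D' →L[ℝ] J.Quot), PreservesLattice T →
           ∀ ε : ℝ, 0 < ε → ∃ S : FBL E D' →L[ℝ] X,
             J.mkQ.comp S = T ∧ ‖S‖ ≤ (1 + ε) * ‖T‖] := by
  have norm_comp : ∀ {F : Type v} [NormedAddCommGroup F] [NormedSpace ℝ F] (T : FBL E D' →L[ℝ] F),
      ‖T.comp (FBL.embedL E D')‖ ≤ ‖T‖ := fun T =>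
    (T.opNorm_comp_le _).trans (mul_le_of_le_one_right (norm_nonneg T) (FBL.norm_embedL_le E D'))
  tfae_have 1 → 2 := by
    intro h X _ _ _ _ hX J T hT ε hε
    obtain ⟨S, hS, hSn⟩ := h X hX J (T.comp (FBL.embedL E D')) ε hε
    obtain ⟨U, hU, hUS, hUn⟩ := FBL.exists_extension (hD X hX) S
    -- The composite of `U` with the quotient map and `T` are lattice homomorphisms agreeing on `E`,
    -- hence equal.
    refine ⟨U, hU, FBL.latticeHom_ext (fun a b => ?_) hT ?_, hUn.trans (hSn.trans ?_)⟩
    · simp only [ContinuousLinearMap.comp_apply, (hU a b).1, (hU a b).2]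
      exact J.mkQ_preservesLattice _ _
    · rw [ContinuousLinearMap.comp_assoc, hUS, hS]
    · exact mul_le_mul_of_nonneg_left (norm_comp T) (by positivity)
  tfae_have 2 → 3 := by
    intro h X _ _ _ _ hX J T hT ε hε
    obtain ⟨S, -, hS⟩ := h X hX J T hT ε hε
    exact ⟨S, hS⟩
  tfae_have 3 → 1 := by
    intro h X _ _ _ _ hX J T ε hε
    obtain ⟨U, hU, hUT, hUn⟩ := FBL.exists_extension (J.isDConvex_quot (hD X hX)) T
    obtain ⟨S, hS, hSn⟩ := h X hX J U hU ε hε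
    refine ⟨S.comp (FBL.embedL E D'), ?_, (norm_comp S).trans (hSn.trans ?_)⟩
    · rw [← ContinuousLinearMap.comp_assoc, hS, hUT]
    · exact mul_le_mul_of_nonneg_left hUn (by positivity)
  tfae_finish
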